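/- Let $k$ be an odd positive integer, $\chi$ a non-principal primitive Dirichlet character modulo $k$, and $\bar\chi$ its complex conjugate. Let $p\ge 1$ be an odd integer and let $a,b,c,d$ be integers with $ad-bc=1$, $c>0$ and $d$ even; put $Tz=(az+b)/(cz+d)$. For $\operatorname{Im} z>0$, $s\in\mathbb{C}$ and any character $\psi$ modulo $k$ define $$H_1(z,s:\psi)=(1+e^{\pi i s})\sum_{n=1}^{\infty}\sum_{m=1}^{\infty}(-1)^m\psi(m)\psi(n)\,n^{s-1}e^{2\pi i mnz/k},$$ $$B_1(z,s:\psi)=(1+e^{\pi i s})\sum_{n=0}^{\infty}\sum_{m=1}^{\infty}\psi(m)\psi(2n+1)\,(2n+1)^{s-1}e^{\pi i m(2n+1)z/k},$$ and $G(\psi)=\sum_{v=0}^{k-1}\psi(v)e^{2\pi i v/k}$. Let $B_n(x)$ and $E_n(x)$ be the Bernoulli and Euler polynomials, given by $\frac{te^{xt}}{e^t-1}=\sum_{n\ge0} B_n(x)\frac{t^n}{n!}$ and $\frac{2e^{xt}}{e^t+1}=\sum_{n\ge0} E_n(x)\frac{t^n}{n!}$. Let $\mathfrak{B}_n$ be the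 $1$-periodic function on $\mathbb{R}$ with $\mathfrak{B}_n(x)=B_n(x)$ for $0\le x<1$, except that $\mathfrak{B}_1(0)=0$. Let $\mathcal{E}_n$ be the function on $\mathbb{R}$ with $\mathcal{E}_n(x)=E_n(x)$ for $0\le x<1$ and $\mathcal{E}_n(x+m)=(-1)^m\mathcal{E}_n(x)$ for $m\in\mathbb{Z}$. Set $$\mathcal{E}_{m,\psi}(x)=k^m\sum_{j=0}^{k-1}(-1)^j\,\bar\psi(j)\,\mathcal{E}_m\!\left(\frac{j+x}{k}\right)\qquad(m\ge0),$$ $$g_1(c,d,z,p,\psi)=\sum_{m=1}^{p}\binom{p}{m}k^{m-p}\bigl(-(cz+d)\bigr)^{m-1}\sum_{n=1}^{ck}\psi(n)\,\mathcal{E}_{p-m,\psi}\!\left(\frac{dn}{c}\right)\mathfrak{B}_m\!\left(\frac{n}{ck}\right).$$ If $a\equiv d\equiv 0\pmod k$, then for every $z$ with $\operatorname{Im} z>0$, $$G(\bar\chi)(cz+d)^{p-1}H_1(Tz,1-p:\chi)=\bar\chi(b)\chi(c)\left(2^p\chi(2)G(\chi)B_1(z,1-p:\bar\chi)-\frac{\chi(-1)(2\pi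 i)^p}{2\,(p!)}\,g_1(c,d,z,p,\bar\chi)\right).$$ If $b\equiv c\equiv 0\pmod k$, then for every $z$ with $\operatorname{Im} z>0$, $$G(\bar\chi)(cz+d)^{p-1}H_1(Tz,1-p:\chi)=\bar\chi(a)\chi(d)\left(2^p\bar\chi(2)G(\bar\chi)B_1(z,1-p:\chi)-\frac{\chi(-1)(2\pi i)^p}{2\,(p!)}\,g_1(c,d,z,p,\chi)\right).$$ -/

import Mathlib

namespace ThetaTwo

noncomputable section

/-- The Bernoulli function `𝔅_n`: the 1-periodic function equal to the Bernoulli polynomial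
`B_n(x)` on `[0, 1)`, except that `𝔅_1` vanishes at the integers. -/
def bernoulliFn (n : ℕ) (x : ℝ) : ℝ :=
  if n = 1 ∧ Int.fract x = 0 then 0 else bernoulliFun n (Int.fract x)

/-- The Euler polynomial `E_n` evaluated at the real number `x`, that is `n!` times the
coefficient of `t ^ n` in the power series `2 * e ^ (x * t) / (e ^ t + 1)`. -/
def eulerPoly (n : ℕ) (x : ℝ) : ℝ :=
  (n.factorial : ℝ) * PowerSeries.coeff n
    (PowerSeries.C (2 : ℝ) * PowerSeries.rescale x (PowerSeries.exp ℝ) *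
      (PowerSeries.exp ℝ + 1)⁻¹)

/-- The Euler function `𝓔_n`: it equals `E_n` on `[0, 1)` and
`𝓔_n (x + m) = (-1) ^ m * 𝓔_n x` for integers `m`. -/
def eulerFn (n : ℕ) (x : ℝ) : ℝ :=
  (-1 : ℝ) ^ ⌊x⌋ * eulerPoly n (Int.fract x)

/-- The character Euler function
`𝓔_{m,χ}(x) = k ^ m ∑_{j=0}^{k-1} (-1)^j χ̄(j) 𝓔_m((j + x) / k)` (used for odd `k`).
Here and below `star χ` is the complex conjugate character `χ̄`. -/
def charEulerFn {k : ℕ} (m : ℕ) (χ : DirichletCharacter ℂ k) (x : ℝ) : ℂ :=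
  (k : ℂ) ^ m * ∑ j ∈ Finset.range k,
    (-1 : ℂ) ^ j * (star χ) (j : ZMod k) * (eulerFn m (((j : ℝ) + x) / (k : ℝ)) : ℂ)

/-- `A₁(z, s : χ) = ∑_{n ≥ 1} ∑_{m ≥ 1} (-1)^m χ(m) χ(n) n^{s-1} e^{2πimnz/k}`. -/
def A1 {k : ℕ} (z s : ℂ) (χ : DirichletCharacter ℂ k) : ℂ :=
  ∑' n : ℕ+, ∑' m : ℕ+, (-1 : ℂ) ^ (m : ℕ) * χ ((m : ℕ) : ZMod k) * χ ((n : ℕ) : ZMod k) *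
    ((n : ℕ) : ℂ) ^ (s - 1) *
    Complex.exp (2 * Real.pi * Complex.I * ((m : ℕ) : ℂ) * ((n : ℕ) : ℂ) * z / (k : ℂ))

/-- `H₁(z, s : χ) = (1 + e^{πis}) A₁(z, s : χ)`. -/
def H1 {k : ℕ} (z s : ℂ) (χ : DirichletCharacter ℂ k) : ℂ :=
  (1 + Complex.exp (Real.pi * Complex.I * s)) * A1 z s χ

/-- `B(z, s : χ) = ∑_{n ≥ 0} ∑_{m ≥ 1} χ(m) χ(2n+1) (2n+1)^{s-1} e^{πim(2n+1)z/k}`. -/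
def B {k : ℕ} (z s : ℂ) (χ : DirichletCharacter ℂ k) : ℂ :=
  ∑' n : ℕ, ∑' m : ℕ+, χ ((m : ℕ) : ZMod k) * χ ((2 * n + 1 : ℕ) : ZMod k) *
    ((2 * n + 1 : ℕ) : ℂ) ^ (s - 1) *
    Complex.exp (Real.pi * Complex.I * ((m : ℕ) : ℂ) * ((2 * n + 1 : ℕ) : ℂ) * z / (k : ℂ))

/-- `B₁(z, s : χ) = (1 + e^{πis}) B(z, s : χ)`. -/
def B1 {k : ℕ} (z s : ℂ) (χ : DirichletCharacter ℂ k) : ℂ :=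
  (1 + Complex.exp (Real.pi * Complex.I * s)) * B z s χ

/-- The Gauss sum `G(χ) = ∑_{v mod k} χ(v) e^{2πiv/k}`. -/
def gauss {k : ℕ} [NeZero k] (χ : DirichletCharacter ℂ k) : ℂ :=
  gaussSum χ (ZMod.stdAddChar (N := k))

/-- `g₁(c, d, z, p, χ) = ∑_{m=1}^{p} (p choose m) k^{m-p} (-(cz+d))^{m-1}
∑_{n=1}^{ck} χ(n) 𝓔_{p-m,χ}(dn/c) 𝔅_m(n/(ck))`. -/
def g1 {k : ℕ} (c d : ℤ) (z : ℂ) (p : ℕ) (χ : DirichletCharacter ℂ k) : ℂ :=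
  ∑ m ∈ Finset.Icc 1 p, (p.choose m : ℂ) * (k : ℂ) ^ ((m : ℤ) - (p : ℤ)) *
    (-((c : ℂ) * z + (d : ℂ))) ^ (m - 1) *
    ∑ n ∈ Finset.Icc (1 : ℤ) (c * (k : ℤ)),
      χ (n : ZMod k) * charEulerFn (p - m) χ ((d : ℝ) * (n : ℝ) / (c : ℝ)) *
        (bernoulliFn m ((n : ℝ) / ((c : ℝ) * (k : ℝ))) : ℂ)

end

end ThetaTwo

namespace ThetaTwo

noncomputable section

/-! The transformation formula is a weighted sum of one residue identity. For x, y in (0, 1) and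
non-real γ, the residues of `expKernel x (γ t) * expKernel y t / t ^ p` add up to zero
(`kernel_identity`); the poles 2πin/γ, 2πin and 0 contribute `firstTerm` (times γ^(p-1)),
`secondTerm` and `bernoulliTerm`. No contour is used. Each kernel has a partial fraction expansion,
obtained from a Fourier series, and the first two families of residues are, up to Bernoulli terms,
the two iterated sums of one absolutely convergent double series. This works for exponents at least
2; differentiating in y lowers the exponent by one and so reaches p = 1.

Now take γ = -(cz+d)/2, x = n/(ck), y = (cJ+dn)/(2ck) modulo 1, and sum over n mod ck and J mod 2k
with weight ψ(n)(-1)^J ψ̄(J). In the second family the J-sum is an alternating Gauss sum, which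
keeps only odd N, and the n-sum is geometric: this is B₁(z). In the first family the unimodular
substitution n = aM + cs, J = -bM - ds turns y into M/(2ck); if the weight factors as a function of
M times χ̄(s) (`WeightSplits`), the s-sum is a Gauss sum and the M-sum yields H₁(Tz), since 1/γ =
2c·Tz - 2a. At the origin the J-sum turns Bernoulli functions into character Euler functions, giving
g₁.

The two congruence hypotheses are two situations in which the weight factors, with ψ = χ̄ and ψ = χ
respectively. -/

/-- The poles `2πin` of `s ↦ (exp s - 1)⁻¹`. -/
def pole (n : ℤ) : ℂ := 2 * Real.pi * Complex.I * n

/-- The generating function `exp (x s) / (exp s - 1)` of the Bernoulli polynomials. -/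
def expKernel (x : ℝ) (s : ℂ) : ℂ := Complex.exp (x * s) / (Complex.exp s - 1)

/-! ### Partial fractions of the Bernoulli kernel. -/

lemma pole_ne_zero {n : ℤ} (hn : n ≠ 0) : pole n ≠ 0 := by
  simp [pole, hn, Real.pi_ne_zero, Complex.I_ne_zero]

lemma exp_sub_one_ne_zero {s : ℂ} (hs : ∀ n : ℤ, s ≠ pole n) : Complex.exp s - 1 ≠ 0 := by
  intro h
  obtain ⟨n, hn⟩ := Complex.exp_eq_one_iff.1 (sub_eq_zero.1 h)
  exact hs n (by rw [hn, pole]; ring)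

lemma hasDerivAt_expKernel (s : ℂ) (x : ℝ) :
    HasDerivAt (fun x : ℝ => expKernel x s) (s * expKernel x s) x := by
  have h : HasDerivAt (fun x : ℝ => Complex.exp ((x : ℂ) * s)) (Complex.exp (x * s) * (1 * s)) x :=
    (HasDerivAt.cexp (((hasDerivAt_id (x : ℂ)).mul_const s))).comp_ofReal
  convert! h.div_const (Complex.exp s - 1) using 1
  simp [expKernel]; ring

lemma expKernel_one_sub_zero {s : ℂ} (hs : Complex.exp s - 1 ≠ 0) :
    expKernel 1 s - expKernel 0 s = 1 := by
  simp only [expKernel, Complex.ofReal_one, one_mul, Complex.ofReal_zero, zero_mul,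
    Complex.exp_zero, ← sub_div, div_self hs]

/-- Removing 1/s and B₁(x) cancels the mean and the jump of the kernel, so the Fourier coefficients
decay quadratically. At n = 0 the convention `0⁻¹ = 0` gives the correct value 0. -/
lemma integral_expKernel_fourier {s : ℂ} (hs : ∀ n : ℤ, s ≠ pole n) (n : ℤ) :
    ∫ x in (0 : ℝ)..1, Complex.exp (-(pole n * x)) *
        (expKernel x s - s⁻¹ - (bernoulliFun 1 x : ℂ)) = s * ((pole n)⁻¹ / (s - pole n)) := by
  have hs0 : s ≠ 0 := by simpa [pole] using hs 0
  have hE := expKernel_one_sub_zero (exp_sub_one_ne_zero hs)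
  have hcont : Continuous fun x : ℝ => Complex.exp (-(pole n * x)) *
      (expKernel x s - s⁻¹ - (bernoulliFun 1 x : ℂ)) := by
    unfold expKernel
    simp only [bernoulliFun_one]
    fun_prop
  have hid (x : ℝ) : HasDerivAt (fun x : ℝ => (x : ℂ)) 1 x := Complex.ofRealCLM.hasDerivAt
  rcases eq_or_ne n 0 with rfl | hn
  · have hd (x : ℝ) : HasDerivAt (fun x : ℝ => expKernel x s / s - s⁻¹ * x - (x : ℂ) ^ 2 / 2 + x / 2)
        (Complex.exp (-(pole 0 * x)) * (expKernel x s - s⁻¹ - (bernoulliFun 1 x : ℂ))) x := by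
      convert! ((((hasDerivAt_expKernel s x).div_const s).sub ((hid x).const_mul s⁻¹)).sub
        (((hid x).pow 2).div_const 2)).add ((hid x).div_const 2) using 1
      simp [pole, bernoulliFun_one]
      field_simp
      ring
    rw [intervalIntegral.integral_eq_sub_of_hasDerivAt (fun x _ => hd x)
      (hcont.intervalIntegrable _ _)]
    rw [sub_eq_iff_eq_add] at hE
    simp [pole, hE]
    field_simp
    ring
  · have hp := pole_ne_zero hn
    have hsp : s - pole n ≠ 0 := sub_ne_zero.2 (hs n)
    have hd (x : ℝ) : HasDerivAt (fun x : ℝ => Complex.exp (-(pole n * x)) *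
        (expKernel x s / (s - pole n) + ((x - 1 / 2 + s⁻¹) / pole n + 1 / pole n ^ 2)))
        (Complex.exp (-(pole n * x)) * (expKernel x s - s⁻¹ - (bernoulliFun 1 x : ℂ))) x := by
      convert! (((hid x).const_mul (pole n)).neg.cexp).mul
        (((hasDerivAt_expKernel s x).div_const (s - pole n)).add
          (((((hid x).sub_const (1 / 2)).add_const s⁻¹).div_const (pole n)).add_const
            (1 / pole n ^ 2))) using 1
      simp [bernoulliFun_one]
      field_simp
      ring
    rw [intervalIntegral.integral_eq_sub_of_hasDerivAt (fun x _ => hd x)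
      (hcont.intervalIntegrable _ _)]
    have he : Complex.exp (-pole n) = 1 := by
      rw [Complex.exp_eq_one_iff]
      exact ⟨-n, by simp [pole]; ring⟩
    rw [sub_eq_iff_eq_add] at hE
    simp [he, hE]
    field_simp
    ring

lemma exp_pole_mul (n : ℤ) (x : ℝ) :
    Complex.exp (pole n * x) = fourier n (x : UnitAddCircle) := by
  rw [fourier_coe_apply]
  simp [pole]

lemma exp_neg_pole_mul (n : ℤ) (x : ℝ) :
    Complex.exp (-(pole n * x)) = fourier (-n) (x : UnitAddCircle) := by
  rw [← exp_pole_mul]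
  simp [pole]

lemma norm_exp_pole_mul (n : ℤ) (x : ℝ) : ‖Complex.exp (pole n * x)‖ = 1 := by
  rw [exp_pole_mul]
  exact Circle.norm_coe _

lemma norm_pole (n : ℤ) : ‖pole n‖ = 2 * Real.pi * |(n : ℝ)| := by
  simp [pole, Real.pi_nonneg]

lemma summable_inv_pole_div_sub (s : ℂ) :
    Summable fun n : ℤ => (pole n)⁻¹ / (s - pole n) := by
  have h1 : Summable fun n : ℤ => ‖(pole n)⁻¹‖ ^ 2 := by
    refine ((Real.summable_one_div_int_pow.2 one_lt_two).mul_left ((2 * Real.pi)⁻¹ ^ 2)).congr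
      fun n => ?_
    rw [norm_inv, norm_pole]
    simp [mul_pow]
    ring
  have h2 : Summable fun n : ℤ => ‖(s - pole n)⁻¹‖ ^ 2 := by
    have := ((EisensteinSeries.linear_right_summable (s / (2 * Real.pi * Complex.I)) (-1)
      (le_refl 2)).norm.mul_left (‖(2 * Real.pi * Complex.I : ℂ)⁻¹‖ ^ 2))
    refine this.congr fun n => ?_
    rw [← norm_pow, ← norm_pow, ← norm_mul, inv_pow, inv_pow, zpow_ofNat, ← mul_inv, ← mul_pow,
      norm_inv, norm_inv, norm_pow, norm_pow]
    congr 2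
    rw [← norm_neg]
    congr 1
    have : (2 * Real.pi * Complex.I : ℂ) ≠ 0 := Complex.two_pi_I_ne_zero
    simp [pole]
    field_simp
    ring
  refine .of_norm_bounded (h1.add h2) fun n => ?_
  rw [div_eq_mul_inv, norm_mul]
  nlinarith [sq_nonneg (‖(pole n)⁻¹‖ - ‖(s - pole n)⁻¹‖), sq_nonneg ‖(pole n)⁻¹‖,
    sq_nonneg ‖(s - pole n)⁻¹‖, norm_nonneg (pole n)⁻¹, norm_nonneg (s - pole n)⁻¹]

/-- Over one period the kernel and B₁ both jump by 1, so the difference is continuous on the circle;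
its coefficients are summable, hence the Fourier series converges pointwise. -/
lemma hasSum_expKernel_fourier {s : ℂ} (hs : ∀ n : ℤ, s ≠ pole n) {x : ℝ}
    (hx : x ∈ Set.Ico (0 : ℝ) 1) :
    HasSum (fun n : ℤ => Complex.exp (pole n * x) * ((pole n)⁻¹ / (s - pole n)))
      (s⁻¹ * (expKernel x s - s⁻¹ - (bernoulliFun 1 x : ℂ))) := by
  have hs0 : s ≠ 0 := by simpa [pole] using hs 0
  let g : ℝ → ℂ := fun x => expKernel x s - s⁻¹ - (bernoulliFun 1 x : ℂ)
  have hg : Continuous g := by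
    simp only [g, expKernel, bernoulliFun_one]
    fun_prop
  have hper : g 0 = g 1 := by
    have hE := expKernel_one_sub_zero (exp_sub_one_ne_zero hs)
    rw [sub_eq_iff_eq_add] at hE
    simp only [g, hE, bernoulliFun_one]
    push_cast
    ring
  let f : C(UnitAddCircle, ℂ) := ⟨AddCircle.liftIco 1 0 g,
    AddCircle.liftIco_zero_continuous hper hg.continuousOn⟩
  have hf (n : ℤ) : fourierCoeff f n = s * ((pole n)⁻¹ / (s - pole n)) := by
    simp only [f, ContinuousMap.coe_mk]
    rw [fourierCoeff_liftIco_eq, fourierCoeffOn_eq_integral]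
    rw [← integral_expKernel_fourier hs n]
    simp [g, exp_neg_pole_mul]
  have h := has_pointwise_sum_fourier_series_of_summable (f := f)
    (((summable_inv_pole_div_sub s).mul_left s).congr fun n => (hf n).symm) x
  have hfx : f (x : UnitAddCircle) = g x := by
    simp only [f, ContinuousMap.coe_mk]
    exact AddCircle.liftIco_coe_apply (show x ∈ Set.Ico (0 : ℝ) (0 + 1) by rwa [zero_add])
  rw [hfx] at h
  convert! h.mul_left s⁻¹ using 1
  ext n
  rw [hf, exp_pole_mul, smul_eq_mul]
  field_simp

lemma hasSum_bernoulli_fourier {k : ℕ} (hk : 2 ≤ k) {x : ℝ} (hx : x ∈ Set.Icc (0 : ℝ) 1) :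
    HasSum (fun n : ℤ => Complex.exp (pole n * x) * (pole n ^ k)⁻¹)
      (-((bernoulliFun k x : ℂ) / k.factorial)) := by
  convert! (hasSum_one_div_pow_mul_fourier_mul_bernoulliFun hk hx).mul_left
    ((2 * Real.pi * Complex.I) ^ k)⁻¹ using 1
  · ext n
    rw [exp_pole_mul, pole, mul_pow, mul_inv]
    ring
  · have : (2 * Real.pi * Complex.I : ℂ) ^ k ≠ 0 := pow_ne_zero _ Complex.two_pi_I_ne_zero
    field_simp

/-- Partial fraction expansion of the generating function of the Bernoulli polynomials, with
`q` terms of its Laurent expansion split off. -/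
lemma hasSum_expKernel {s : ℂ} (hs : ∀ n : ℤ, s ≠ pole n) {x : ℝ}
    (hx : x ∈ Set.Ico (0 : ℝ) 1) (q : ℕ) :
    HasSum (fun n : ℤ => Complex.exp (pole n * x) * ((pole n ^ (q + 1))⁻¹ / (s - pole n)))
      ((s ^ (q + 1))⁻¹ * (expKernel x s -
        ∑ m ∈ Finset.range (q + 2), s ^ m / s * ((bernoulliFun m x : ℂ) / m.factorial))) := by
  have hs0 : s ≠ 0 := by simpa [pole] using hs 0
  induction q with
  | zero =>
    convert! hasSum_expKernel_fourier hs hx using 1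
    · simp
    · simp [Finset.sum_range_succ, bernoulliFun_zero, hs0, sub_sub]
  | succ q ih =>
    have hB := hasSum_bernoulli_fourier (k := q + 2) (by lia) (Set.Ico_subset_Icc_self hx)
    -- For ρ = `pole n` ≠ 0: ρ^(-q-2)/(s-ρ) = s⁻¹ (ρ^(-q-1)/(s-ρ) + ρ^(-q-2)), and the last terms
    -- sum to a Bernoulli value.
    convert! (ih.add hB).mul_left s⁻¹ using 1
    · ext n
      rcases eq_or_ne n 0 with rfl | hn
      · simp [pole]
      · have hp := pole_ne_zero hn
        have hsp : s - pole n ≠ 0 := sub_ne_zero.2 (hs n)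
        field_simp
        ring
    · rw [Finset.sum_range_succ _ (q + 2)]
      field_simp
      ring

/-! ### The double series and the residue identity for exponents at least 2. -/

lemma im_mul_pole_left_le (γ : ℂ) (N M : ℤ) :
    2 * Real.pi * (|γ.im| * |(M : ℝ)|) ≤ ‖pole N - γ * pole M‖ := by
  have h : pole N - γ * pole M = 2 * Real.pi * Complex.I * (N - γ * M) := by
    simp only [pole]; ring
  rw [h, norm_mul]
  have h2 : ‖(2 * Real.pi * Complex.I : ℂ)‖ = 2 * Real.pi := by simp [Real.pi_nonneg]
  rw [h2]
  gcongr
  calc |γ.im| * |(M : ℝ)| = |((N : ℂ) - γ * M).im| := by simp [abs_mul]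
    _ ≤ _ := Complex.abs_im_le_norm _

lemma im_mul_pole_right_le (γ : ℂ) (N M : ℤ) :
    2 * Real.pi * (|γ.im| * |(N : ℝ)|) ≤ ‖pole N - γ * pole M‖ * ‖γ‖ := by
  have h : pole N - γ * pole M = 2 * Real.pi * Complex.I * (N - γ * M) := by
    simp only [pole]; ring
  rw [h, norm_mul]
  have h2 : ‖(2 * Real.pi * Complex.I : ℂ)‖ = 2 * Real.pi := by simp [Real.pi_nonneg]
  rw [h2, mul_assoc (2 * Real.pi)]
  refine mul_le_mul_of_nonneg_left ?_ (by positivity)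
  calc |γ.im| * |(N : ℝ)| = |(((N : ℂ) - γ * M) * (starRingEnd ℂ) γ).im| := by
        rw [← abs_mul, ← abs_neg]
        congr 1
        simp
        ring
    _ ≤ ‖((N : ℂ) - γ * M) * (starRingEnd ℂ) γ‖ := Complex.abs_im_le_norm _
    _ = _ := by rw [norm_mul, Complex.norm_conj]

/-- The general term of the double series behind the kernel identity. -/
def doubleTerm (q : ℕ) (γ : ℂ) (x y : ℝ) (N M : ℤ) : ℂ :=
  Complex.exp (pole N * x) * Complex.exp (pole M * y) *
    ((pole N ^ (q + 1))⁻¹ * (pole M)⁻¹ / (pole N - γ * pole M))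

lemma summable_doubleTerm (q : ℕ) {γ : ℂ} (hγ : γ.im ≠ 0) (x y : ℝ) :
    Summable fun i : ℤ × ℤ => doubleTerm q γ x y i.1 i.2 := by
  have hγ0 : 0 < ‖γ‖ := norm_pos_iff.2 fun h => hγ (by simp [h])
  have him : 0 < |γ.im| := abs_pos.2 hγ
  have hS : Summable fun n : ℤ => |(n : ℝ)| ^ (-(3 / 2 : ℝ)) :=
    Real.summable_abs_int_rpow (by norm_num)
  refine .of_norm_bounded ((hS.mul_of_nonneg hS (fun _ => by positivity)
    (fun _ => by positivity)).mul_left (√‖γ‖ / |γ.im|)) fun ⟨N, M⟩ => ?_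
  simp only [doubleTerm, norm_mul, norm_div, norm_inv, norm_pow, norm_exp_pole_mul, one_mul]
  rcases eq_or_ne N 0 with rfl | hN
  · simp [pole]
  rcases eq_or_ne M 0 with rfl | hM
  · simp [pole]
  have hN1 : 1 ≤ |(N : ℝ)| := by exact_mod_cast Int.one_le_abs hN
  have hM1 : 1 ≤ |(M : ℝ)| := by exact_mod_cast Int.one_le_abs hM
  have hpi : 1 ≤ 2 * Real.pi := by linarith [Real.pi_gt_three]
  have hpN : |(N : ℝ)| ≤ ‖pole N‖ := by rw [norm_pole]; nlinarith
  have hpM : |(M : ℝ)| ≤ ‖pole M‖ := by rw [norm_pole]; nlinarith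
  have hpN' : |(N : ℝ)| ≤ ‖pole N‖ ^ (q + 1) :=
    hpN.trans (le_self_pow₀ (hN1.trans hpN) (by simp))
  -- The distance from N to γM dominates both |M| and |N|, hence their geometric mean. The general
  -- term is then at most a constant times (|N||M|)^(-3/2).
  have hsq : |γ.im| * (√|(N : ℝ)| * √|(M : ℝ)|) ≤ ‖pole N - γ * pole M‖ * √‖γ‖ := by
    refine abs_le_of_sq_le_sq' ?_ (by positivity) |>.2
    simp only [mul_pow, Real.sq_sqrt (abs_nonneg _), Real.sq_sqrt hγ0.le]
    have h1 : |γ.im| * |(M : ℝ)| ≤ ‖pole N - γ * pole M‖ :=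
      le_trans (le_mul_of_one_le_left (by positivity) hpi) (im_mul_pole_left_le γ N M)
    have h2 : |γ.im| * |(N : ℝ)| ≤ ‖pole N - γ * pole M‖ * ‖γ‖ :=
      le_trans (le_mul_of_one_le_left (by positivity) hpi) (im_mul_pole_right_le γ N M)
    calc |γ.im| ^ 2 * (|(N : ℝ)| * |(M : ℝ)|) = (|γ.im| * |(M : ℝ)|) * (|γ.im| * |(N : ℝ)|) := by
          ring
      _ ≤ ‖pole N - γ * pole M‖ * (‖pole N - γ * pole M‖ * ‖γ‖) := by gcongr
      _ = _ := by ring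
  have hr (t : ℝ) (ht : 1 ≤ t) : t ^ (-(3 / 2 : ℝ)) = t⁻¹ * (√t)⁻¹ := by
    have ht0 : 0 < t := by linarith
    rw [Real.sqrt_eq_rpow, Real.rpow_neg ht0.le, ← mul_inv, ← Real.rpow_one_add' ht0.le (by norm_num)]
    norm_num
  have hden : |γ.im| * (√|(N : ℝ)| * √|(M : ℝ)|) / √‖γ‖ ≤ ‖pole N - γ * pole M‖ := by
    rwa [div_le_iff₀ (by positivity)]
  rw [hr _ hN1, hr _ hM1]
  calc (‖pole N‖ ^ (q + 1))⁻¹ * ‖pole M‖⁻¹ / ‖pole N - γ * pole M‖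
      ≤ |(N : ℝ)|⁻¹ * |(M : ℝ)|⁻¹ / (|γ.im| * (√|(N : ℝ)| * √|(M : ℝ)|) / √‖γ‖) := by
        gcongr
    _ = _ := by field_simp

lemma mul_pole_ne_pole {γ : ℂ} (hγ : γ.im ≠ 0) {M : ℤ} (hM : M ≠ 0) (N : ℤ) :
    γ * pole M ≠ pole N := by
  intro h
  have := im_mul_pole_left_le γ N M
  rw [h, sub_self, norm_zero] at this
  have h1 : 0 < 2 * Real.pi * (|γ.im| * |(M : ℝ)|) := by positivity
  linarith

lemma pole_div_ne_pole {γ : ℂ} (hγ : γ.im ≠ 0) {N : ℤ} (hN : N ≠ 0) (M : ℤ) :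
    pole N / γ ≠ pole M := by
  have hγ0 : γ ≠ 0 := fun h => hγ (by simp [h])
  rw [Ne, div_eq_iff hγ0]
  intro h
  have := im_mul_pole_right_le γ N M
  rw [h, mul_comm γ, sub_self, norm_zero, zero_mul] at this
  have h1 : 0 < 2 * Real.pi * (|γ.im| * |(N : ℝ)|) := by positivity
  linarith

/-- The residues at the poles of `t ↦ expKernel x (γ t)`. -/
def firstTerm (p : ℕ) (γ : ℂ) (x y : ℝ) (n : ℤ) : ℂ :=
  (pole n ^ p)⁻¹ * Complex.exp (pole n * x) * expKernel y (pole n / γ)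

/-- The residues at the poles of `t ↦ expKernel y t`. -/
def secondTerm (p : ℕ) (γ : ℂ) (x y : ℝ) (n : ℤ) : ℂ :=
  (pole n ^ p)⁻¹ * Complex.exp (pole n * y) * expKernel x (γ * pole n)

/-- The residue at the origin. -/
def bernoulliTerm (p : ℕ) (γ : ℂ) (x y : ℝ) : ℂ :=
  ∑ m ∈ Finset.range (p + 2), γ ^ m / γ * ((bernoulliFun m x : ℂ) / m.factorial) *
    ((bernoulliFun (p + 1 - m) y : ℂ) / (p + 1 - m).factorial)

/-- Summing `doubleTerm` over M expands the kernel in y at `pole N / γ`. The two Laurent terms split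
off there are summed over N by the Bernoulli Fourier series. -/
lemma hasSum_firstTerm (q : ℕ) {γ : ℂ} (hγ : γ.im ≠ 0) {x y : ℝ} (hx : x ∈ Set.Ico (0 : ℝ) 1)
    (hy : y ∈ Set.Ico (0 : ℝ) 1) :
    HasSum (firstTerm (q + 2) γ x y)
      ((∑' N : ℤ, ∑' M : ℤ, doubleTerm q γ x y N M) -
        (γ * ((bernoulliFun (q + 3) x : ℂ) / (q + 3).factorial) +
          bernoulliFun 1 y * ((bernoulliFun (q + 2) x : ℂ) / (q + 2).factorial))) := by
  have hγ0 : γ ≠ 0 := fun h => hγ (by simp [h])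
  have hD := ((summable_doubleTerm q hγ x y).prod).hasSum
  have h3 := (hasSum_bernoulli_fourier (k := q + 3) (by lia)
    (Set.Ico_subset_Icc_self hx)).mul_left γ
  have h2 := (hasSum_bernoulli_fourier (k := q + 2) (by lia)
    (Set.Ico_subset_Icc_self hx)).mul_left (bernoulliFun 1 y : ℂ)
  convert! hD.add (h3.add h2) using 1
  · ext N
    rcases eq_or_ne N 0 with rfl | hN
    · simp [firstTerm, doubleTerm, pole]
    have hp := pole_ne_zero hN
    have h := (hasSum_expKernel (s := pole N / γ) (fun n => pole_div_ne_pole hγ hN n) hy 0).mul_left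
      ((pole N ^ (q + 2))⁻¹ * Complex.exp (pole N * x) * (pole N / γ))
    have hterm : (fun M : ℤ => (pole N ^ (q + 2))⁻¹ * Complex.exp (pole N * x) * (pole N / γ) *
        (Complex.exp (pole M * y) * ((pole M ^ (0 + 1))⁻¹ / (pole N / γ - pole M)))) =
        fun M => doubleTerm q γ x y N M := by
      ext M
      have hs : pole N / γ - pole M ≠ 0 := sub_ne_zero.2 (pole_div_ne_pole hγ hN M)
      have hs' : pole N - γ * pole M = γ * (pole N / γ - pole M) := by field_simp
      rcases eq_or_ne M 0 with rfl | hM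
      · simp [doubleTerm, pole]
      have := pole_ne_zero hM
      rw [doubleTerm, hs']
      field_simp
      ring
    rw [hterm] at h
    rw [h.tsum_eq]
    simp only [firstTerm, Finset.sum_range_succ, Finset.sum_range_zero, bernoulliFun_zero]
    simp
    field_simp
    ring
  · ring

/-- The same double series, summed over N first: this expands the kernel in x at `γ * pole M`, with
q + 2 Laurent terms split off. -/
lemma hasSum_secondTerm (q : ℕ) {γ : ℂ} (hγ : γ.im ≠ 0) {x y : ℝ} (hx : x ∈ Set.Ico (0 : ℝ) 1)
    (hy : y ∈ Set.Ico (0 : ℝ) 1) :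
    HasSum (secondTerm (q + 2) γ x y)
      (-γ ^ (q + 1) * (∑' M : ℤ, ∑' N : ℤ, doubleTerm q γ x y N M) -
        ∑ m ∈ Finset.range (q + 2), γ ^ m / γ * ((bernoulliFun m x : ℂ) / m.factorial) *
          ((bernoulliFun (q + 3 - m) y : ℂ) / (q + 3 - m).factorial)) := by
  have hγ0 : γ ≠ 0 := fun h => hγ (by simp [h])
  have hD := (((summable_doubleTerm q hγ x y).prod_symm.prod).hasSum).mul_left (-γ ^ (q + 1))
  have hB := hasSum_sum (s := Finset.range (q + 2)) fun m hm =>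
    (hasSum_bernoulli_fourier (k := q + 3 - m) (by have := Finset.mem_range.1 hm; lia)
      (Set.Ico_subset_Icc_self hy)).mul_left (γ ^ m / γ * ((bernoulliFun m x : ℂ) / m.factorial))
  convert! hD.add hB using 1
  · ext M
    rcases eq_or_ne M 0 with rfl | hM
    · simp only [secondTerm, doubleTerm, pole]
      simp
      rw [Finset.sum_eq_zero]
      intro m hm
      have := Finset.mem_range.1 hm
      simp
      lia
    have hp := pole_ne_zero hM
    have h := (hasSum_expKernel (s := γ * pole M) (fun n => mul_pole_ne_pole hγ hM n) hx q).mul_left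
      ((pole M)⁻¹ * Complex.exp (pole M * y) )
    have hterm : (fun N : ℤ => (pole M)⁻¹ * Complex.exp (pole M * y) *
        (Complex.exp (pole N * x) * ((pole N ^ (q + 1))⁻¹ / (γ * pole M - pole N)))) =
        fun N => - doubleTerm q γ x y N M := by
      ext N
      have hs' : pole N - γ * pole M = -(γ * pole M - pole N) := by ring
      rw [doubleTerm, hs', div_neg]
      ring
    rw [hterm] at h
    have h' := h.neg.tsum_eq
    simp only [neg_neg] at h'
    simp only [Prod.swap]
    rw [h']
    have hsum : ∑ m ∈ Finset.range (q + 2), γ ^ m / γ * ((bernoulliFun m x : ℂ) / m.factorial) *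
          (Complex.exp (pole M * y) * (pole M ^ (q + 3 - m))⁻¹) =
        (pole M ^ (q + 2))⁻¹ * Complex.exp (pole M * y) * ∑ m ∈ Finset.range (q + 2),
          (γ * pole M) ^ m / (γ * pole M) * ((bernoulliFun m x : ℂ) / m.factorial) := by
      rw [Finset.mul_sum]
      refine Finset.sum_congr rfl fun m hm => ?_
      have hm := Finset.mem_range.1 hm
      obtain ⟨r, hr⟩ : ∃ r, q + 2 = m + r := ⟨q + 2 - m, by lia⟩
      have e1 : q + 3 - m = r + 1 := by lia
      rw [e1, hr, mul_pow]
      field_simp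
      ring
    rw [hsum, secondTerm]
    field_simp
    ring
  · simp only [mul_neg, Finset.sum_neg_distrib, Prod.swap]
    ring

/-- Interchanging the order of summation cancels the double series. The first family leaves the last
two summands of `bernoulliTerm`, the second leaves all the others. -/
lemma kernel_identity_add_two (q : ℕ) {γ : ℂ} (hγ : γ.im ≠ 0) {x y : ℝ}
    (hx : x ∈ Set.Ico (0 : ℝ) 1) (hy : y ∈ Set.Ico (0 : ℝ) 1) :
    γ ^ (q + 1) * (∑' n, firstTerm (q + 2) γ x y n) + (∑' n, secondTerm (q + 2) γ x y n) +
      bernoulliTerm (q + 2) γ x y = 0 := by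
  have hγ0 : γ ≠ 0 := fun h => hγ (by simp [h])
  rw [(hasSum_firstTerm q hγ hx hy).tsum_eq, (hasSum_secondTerm q hγ hx hy).tsum_eq,
    (show Summable (Function.uncurry (doubleTerm q γ x y)) from
      summable_doubleTerm q hγ x y).tsum_comm, bernoulliTerm]
  rw [Finset.sum_range_succ _ (q + 3), Finset.sum_range_succ _ (q + 2)]
  have e1 : q + 2 + 1 - (q + 2) = 1 := by lia
  have e2 : q + 2 + 1 - (q + 3) = 0 := by lia
  rw [e1, e2]
  simp [bernoulliFun_zero]
  field_simp
  ring

/-! ### Termwise differentiation in y, to reach exponent 1. -/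

/-- For y inside (0, 1) the kernel decays exponentially as Re s → ±∞; a quadratic bound, uniform for
y in [ε, 1-ε], suffices for domination. -/
lemma norm_expKernel_le {ε η y : ℝ} (hε : 0 < ε) (hη : 0 < η) (hy : y ∈ Set.Icc ε (1 - ε)) {s : ℂ}
    (hs : η ≤ |s.re|) :
    ‖expKernel y s‖ ≤ 2 / ((1 - Real.exp (-η)) * ε ^ 2) * (s.re ^ 2)⁻¹ := by
  have hη1 : 0 < 1 - Real.exp (-η) := by
    have := Real.exp_lt_one_iff.2 (neg_lt_zero.2 hη)
    linarith
  have hs0 : 0 < |s.re| := hη.trans_le hs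
  have hden : |Real.exp s.re - 1| ≤ ‖Complex.exp s - 1‖ := by
    have := abs_norm_sub_norm_le (Complex.exp s) 1
    rwa [Complex.norm_exp, norm_one] at this
  have hnum : ‖Complex.exp (y * s)‖ = Real.exp (y * s.re) := by
    rw [Complex.norm_exp]
    simp
  have key : Real.exp (y * s.re) * (1 - Real.exp (-η)) ≤
      Real.exp (-(ε * |s.re|)) * |Real.exp s.re - 1| := by
    obtain ⟨hy1, hy2⟩ := hy
    rcases le_or_gt 0 s.re with h | h
    · rw [abs_of_nonneg h] at hs ⊢
      have h1 : 1 ≤ Real.exp s.re := Real.one_le_exp h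
      rw [abs_of_nonneg (by linarith)]
      calc Real.exp (y * s.re) * (1 - Real.exp (-η))
          ≤ Real.exp (-(ε * s.re) + s.re) * (1 - Real.exp (-s.re)) := by
            have : Real.exp (-s.re) ≤ Real.exp (-η) := Real.exp_le_exp.2 (by linarith)
            refine mul_le_mul (Real.exp_le_exp.2 (by nlinarith)) (by linarith) hη1.le
              (Real.exp_pos _).le
        _ = _ := by
            rw [Real.exp_add, mul_assoc, mul_sub, ← Real.exp_add]
            simp
    · rw [abs_of_neg h] at hs ⊢
      have h1 : Real.exp s.re ≤ Real.exp (-η) := Real.exp_le_exp.2 (by linarith)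
      rw [abs_of_nonpos (by linarith)]
      refine mul_le_mul (Real.exp_le_exp.2 (by nlinarith)) (by linarith) hη1.le (Real.exp_pos _).le
  have hpos : 0 < |Real.exp s.re - 1| := by
    rw [abs_pos, sub_ne_zero, Ne, Real.exp_eq_one_iff]
    exact abs_pos.1 hs0
  have hexp : Real.exp (-(ε * |s.re|)) ≤ 2 / (ε ^ 2 * s.re ^ 2) := by
    rw [Real.exp_neg, ← sq_abs s.re, ← mul_pow]
    have ht : 0 < ε * |s.re| := mul_pos hε hs0
    have := Real.quadratic_le_exp_of_nonneg ht.le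
    rw [inv_le_comm₀ (Real.exp_pos _) (by positivity), inv_div]
    linarith
  calc ‖expKernel y s‖ ≤ Real.exp (y * s.re) / |Real.exp s.re - 1| := by
        rw [expKernel, norm_div, hnum]
        gcongr
    _ ≤ Real.exp (-(ε * |s.re|)) / (1 - Real.exp (-η)) := by
        rwa [div_le_div_iff₀ hpos hη1]
    _ ≤ 2 / (ε ^ 2 * s.re ^ 2) / (1 - Real.exp (-η)) := by gcongr
    _ = _ := by
        have := abs_pos.1 hs0
        field_simp

lemma summable_norm_bound {ε : ℝ} (hε : 0 < ε) {θ : ℂ} (hθ : θ.im ≠ 0) :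
    ∃ u : ℤ → ℝ, Summable u ∧ (∀ n, 0 ≤ u n) ∧ ∀ n ≠ 0, ∀ y ∈ Set.Icc ε (1 - ε),
      ‖expKernel y (θ * pole n)‖ ≤ u n := by
  have hre (n : ℤ) : (θ * pole n).re = -(2 * Real.pi * θ.im) * n := by
    simp [pole]; ring
  have h0 : 0 < |2 * Real.pi * θ.im| := by positivity
  refine ⟨fun n => 2 / ((1 - Real.exp (-|2 * Real.pi * θ.im|)) * ε ^ 2) *
    ((2 * Real.pi * θ.im) ^ 2)⁻¹ * (1 / (n : ℝ) ^ 2),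
    (Real.summable_one_div_int_pow.2 one_lt_two).mul_left _, fun n => ?_, fun n hn y hy => ?_⟩
  · have : 0 < 1 - Real.exp (-|2 * Real.pi * θ.im|) := by
      have := Real.exp_lt_one_iff.2 (neg_lt_zero.2 h0)
      linarith
    positivity
  · refine (norm_expKernel_le hε h0 hy (s := θ * pole n) ?_).trans_eq ?_
    · rw [hre, abs_mul _ (n : ℝ), abs_neg]
      refine le_mul_of_one_le_right h0.le ?_
      exact_mod_cast Int.one_le_abs hn
    · rw [hre, neg_mul, neg_sq, mul_pow _ (n : ℝ), mul_inv]
      ring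

lemma one_le_norm_pole {n : ℤ} (hn : n ≠ 0) : 1 ≤ ‖pole n‖ := by
  rw [norm_pole]
  have h1 : (1 : ℝ) ≤ |(n : ℝ)| := by exact_mod_cast Int.one_le_abs hn
  nlinarith [Real.pi_gt_three]

lemma norm_inv_pole_pow_mul_le {p : ℕ} (hp : p ≠ 0) (x : ℝ) (n : ℤ) {w : ℂ} {u : ℝ} (hu : 0 ≤ u)
    (hw : n ≠ 0 → ‖w‖ ≤ u) :
    ‖(pole n ^ p)⁻¹ * Complex.exp (pole n * x) * w‖ ≤ u := by
  rcases eq_or_ne n 0 with rfl | hn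
  · simpa [pole, hp] using hu
  · rw [norm_mul, norm_mul, norm_exp_pole_mul, mul_one, norm_inv, norm_pow]
    calc _ ≤ 1 * ‖w‖ := by
          gcongr
          exact inv_le_one_of_one_le₀ (one_le_pow₀ (one_le_norm_pole hn))
      _ ≤ u := by simpa using hw hn

lemma inv_im_ne_zero {γ : ℂ} (hγ : γ.im ≠ 0) : (γ⁻¹).im ≠ 0 := by
  have hγ0 : γ ≠ 0 := fun h => hγ (by simp [h])
  simp [Complex.inv_im, hγ, hγ0]

lemma exists_mem_Icc {y : ℝ} (hy : y ∈ Set.Ioo (0 : ℝ) 1) :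
    ∃ ε > 0, y ∈ Set.Ioo ε (1 - ε) := by
  obtain ⟨h0, h1⟩ := hy
  refine ⟨min y (1 - y) / 2, by simp [h0, h1], ?_, ?_⟩
  · linarith [min_le_left y (1 - y)]
  · linarith [min_le_right y (1 - y)]

lemma summable_secondTerm {p : ℕ} (hp : p ≠ 0) {γ : ℂ} (hγ : γ.im ≠ 0) {x : ℝ} (y : ℝ)
    (hx : x ∈ Set.Ioo (0 : ℝ) 1) : Summable (secondTerm p γ x y) := by
  obtain ⟨ε, hε, hxε⟩ := exists_mem_Icc hx
  obtain ⟨u, hu, hu0, hb⟩ := summable_norm_bound hε hγ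
  exact .of_norm_bounded hu fun n => norm_inv_pole_pow_mul_le hp y n (hu0 n)
    fun hn => hb n hn x (Set.Ioo_subset_Icc_self hxε)

lemma summable_firstTerm {p : ℕ} (hp : p ≠ 0) {γ : ℂ} (hγ : γ.im ≠ 0) (x : ℝ) {y : ℝ}
    (hy : y ∈ Set.Ioo (0 : ℝ) 1) : Summable (firstTerm p γ x y) := by
  obtain ⟨ε, hε, hyε⟩ := exists_mem_Icc hy
  obtain ⟨u, hu, hu0, hb⟩ := summable_norm_bound hε (inv_im_ne_zero hγ)
  refine .of_norm_bounded hu fun n => norm_inv_pole_pow_mul_le hp x n (hu0 n) fun hn => ?_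
  rw [div_eq_inv_mul]
  exact hb n hn y (Set.Ioo_subset_Icc_self hyε)

lemma hasDerivAt_bernoulliTerm (p : ℕ) (γ : ℂ) (x y : ℝ) :
    HasDerivAt (fun y : ℝ => bernoulliTerm (p + 1) γ x y) (bernoulliTerm p γ x y) y := by
  have h (n : ℕ) : HasDerivAt (fun y : ℝ => (bernoulliFun n y : ℂ)) (n * bernoulliFun (n - 1) y : ℂ)
      y := by
    have := (hasDerivAt_bernoulliFun n y).ofReal_comp
    simpa using! this
  unfold bernoulliTerm
  have hs := HasDerivAt.fun_sum (u := Finset.range (p + 1 + 2)) fun m _ =>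
    ((h (p + 1 + 1 - m)).div_const ((p + 1 + 1 - m).factorial : ℂ)).const_mul
      (γ ^ m / γ * ((bernoulliFun m x : ℂ) / m.factorial))
  convert! hs using 1
  rw [Finset.sum_range_succ _ (p + 2)]
  have e0 : p + 1 + 1 - (p + 2) = 0 := by lia
  rw [e0]
  simp only [Nat.cast_zero, zero_mul, zero_div, mul_zero, add_zero]
  refine Finset.sum_congr rfl fun m hm => ?_
  obtain ⟨r, hr⟩ : ∃ r, p + 1 = m + r := ⟨p + 1 - m, by have := Finset.mem_range.1 hm; lia⟩
  have e1 : p + 1 - m = r := by lia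
  have e2 : p + 1 + 1 - m = r + 1 := by lia
  rw [e1, e2, Nat.factorial_succ]
  have : ((r : ℂ) + 1) ≠ 0 := by exact_mod_cast r.succ_ne_zero
  have h2 : (r.factorial : ℂ) ≠ 0 := by exact_mod_cast r.factorial_ne_zero
  push_cast
  field_simp

lemma hasDerivAt_tsum_secondTerm {p : ℕ} (hp : p ≠ 0) {γ : ℂ} (hγ : γ.im ≠ 0) {x : ℝ} (y : ℝ)
    (hx : x ∈ Set.Ioo (0 : ℝ) 1) :
    HasDerivAt (fun y => ∑' n, secondTerm (p + 1) γ x y n) (∑' n, secondTerm p γ x y n) y := by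
  obtain ⟨ε, hε, hxε⟩ := exists_mem_Icc hx
  obtain ⟨u, hu, hu0, hb⟩ := summable_norm_bound hε hγ
  refine hasDerivAt_tsum (g := fun n y => secondTerm (p + 1) γ x y n)
    (g' := fun n y => secondTerm p γ x y n) hu (fun n y => ?_) (fun n y => norm_inv_pole_pow_mul_le hp y n (hu0 n)
    fun hn => hb n hn x (Set.Ioo_subset_Icc_self hxε)) (summable_secondTerm p.succ_ne_zero hγ y hx) y
  have h : HasDerivAt (fun y : ℝ => Complex.exp (pole n * (y : ℂ)))
      (Complex.exp (pole n * y) * (pole n * 1)) y :=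
    (HasDerivAt.cexp ((hasDerivAt_id (y : ℂ)).const_mul (pole n))).comp_ofReal
  convert! (h.const_mul (pole n ^ (p + 1))⁻¹).mul_const (expKernel x (γ * pole n)) using 1
  rcases eq_or_ne n 0 with rfl | hn
  · simp [secondTerm, pole, hp]
  · have := pole_ne_zero hn
    simp only [secondTerm]
    field_simp
    ring

/-- Here y enters through the kernel itself, so domination holds only on a compact subinterval of
(0, 1), and the argument is local. -/
lemma hasDerivAt_tsum_firstTerm {p : ℕ} (hp : p ≠ 0) {γ : ℂ} (hγ : γ.im ≠ 0) (x : ℝ) {y : ℝ}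
    (hy : y ∈ Set.Ioo (0 : ℝ) 1) :
    HasDerivAt (fun y => γ * ∑' n, firstTerm (p + 1) γ x y n) (∑' n, firstTerm p γ x y n) y := by
  have hγ0 : γ ≠ 0 := fun h => hγ (by simp [h])
  obtain ⟨ε, hε, hyε⟩ := exists_mem_Icc hy
  obtain ⟨u, hu, hu0, hb⟩ := summable_norm_bound hε (inv_im_ne_zero hγ)
  have hfun : (fun y => γ * ∑' n, firstTerm (p + 1) γ x y n) =
      fun y => ∑' n, γ * firstTerm (p + 1) γ x y n := by
    ext y
    rw [tsum_mul_left]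
  rw [hfun]
  refine hasDerivAt_tsum_of_isPreconnected (g := fun n y => γ * firstTerm (p + 1) γ x y n)
    (g' := fun n y => firstTerm p γ x y n) (t := Set.Ioo ε (1 - ε)) hu isOpen_Ioo
    isPreconnected_Ioo (fun n y _ => ?_)
    (fun n y hy' => norm_inv_pole_pow_mul_le hp x n (hu0 n) fun hn => ?_) hyε
    ((summable_firstTerm p.succ_ne_zero hγ x hy).mul_left γ) hyε
  · convert! ((hasDerivAt_expKernel (pole n / γ) y).const_mul
      ((pole n ^ (p + 1))⁻¹ * Complex.exp (pole n * x))).const_mul γ using 1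
    rcases eq_or_ne n 0 with rfl | hn
    · simp [firstTerm, pole, hp]
    · have := pole_ne_zero hn
      simp only [firstTerm]
      field_simp
      ring
  · rw [div_eq_inv_mul]
    exact hb n hn y (Set.Ioo_subset_Icc_self hy')

/-- The residues of `t ↦ expKernel x (γ t) * expKernel y t / t ^ p` sum up to zero. -/
theorem kernel_identity {p : ℕ} (hp : p ≠ 0) {γ : ℂ} (hγ : γ.im ≠ 0) {x y : ℝ}
    (hx : x ∈ Set.Ioo (0 : ℝ) 1) (hy : y ∈ Set.Ioo (0 : ℝ) 1) :
    γ ^ (p - 1) * (∑' n, firstTerm p γ x y n) + (∑' n, secondTerm p γ x y n) +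
      bernoulliTerm p γ x y = 0 := by
  obtain ⟨q, rfl⟩ := Nat.exists_eq_succ_of_ne_zero hp
  -- The left side at exponent p is the y-derivative of the left side at p + 1, which vanishes
  -- identically near y.
  have h := (((hasDerivAt_tsum_firstTerm hp hγ x hy).const_mul (γ ^ q)).add
    (hasDerivAt_tsum_secondTerm hp hγ y hx)).add (hasDerivAt_bernoulliTerm (q + 1) γ x y)
  refine h.unique ((hasDerivAt_const y (0 : ℂ)).congr_of_eventuallyEq ?_)
  filter_upwards [isOpen_Ioo.mem_nhds hy] with t ht
  have := kernel_identity_add_two q hγ (Set.Ioo_subset_Ico_self hx) (Set.Ioo_subset_Ico_self ht)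
  simp only [Pi.add_apply]
  rw [← mul_assoc, ← pow_succ]
  exact this

/-! ### Euler functions through Bernoulli functions. -/

/-- The right-continuous periodic Bernoulli function. -/
def bernoulliPer (n : ℕ) (x : ℝ) : ℝ := bernoulliFun n (Int.fract x)

lemma bernoulliFun_powerSeries (t : ℝ) :
    (PowerSeries.mk fun n => bernoulliFun n t / n.factorial) * (PowerSeries.exp ℝ - 1) =
      PowerSeries.X * PowerSeries.rescale t (PowerSeries.exp ℝ) := by
  rw [← Polynomial.bernoulli_generating_function]
  congr 2
  ext n
  simp [bernoulliFun, Polynomial.aeval_def, Polynomial.eval_map, Algebra.smul_def]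
  ring

lemma rescale_two_exp : PowerSeries.rescale (2 : ℝ) (PowerSeries.exp ℝ) =
    PowerSeries.exp ℝ * PowerSeries.exp ℝ := by
  have h := PowerSeries.exp_mul_exp_eq_exp_add (A := ℝ) 1 1
  rw [one_add_one_eq_two] at h
  simpa using h.symm

/-- Euler polynomials in terms of Bernoulli polynomials. -/
lemma eulerPoly_eq (n : ℕ) (y : ℝ) :
    eulerPoly n y = 2 ^ (n + 1) / (n + 1) *
      (bernoulliFun (n + 1) ((y + 1) / 2) - bernoulliFun (n + 1) (y / 2)) := by
  set e := PowerSeries.exp ℝ with he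
  let β (t : ℝ) : PowerSeries ℝ :=
    PowerSeries.rescale (2 : ℝ) (PowerSeries.mk fun n => bernoulliFun n t / n.factorial)
  have hβ (t : ℝ) : β t * (e * e - 1) =
      2 * PowerSeries.X * PowerSeries.rescale (2 * t) e := by
    have h := congrArg (PowerSeries.rescale (2 : ℝ)) (bernoulliFun_powerSeries t)
    rw [map_mul, map_mul, map_sub, map_one, rescale_two_exp, PowerSeries.rescale_rescale,
      PowerSeries.rescale_X] at h
    rw [h, mul_comm t]
    rfl
  have hc : PowerSeries.constantCoeff (e + 1) ≠ 0 := by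
    rw [map_add, he, PowerSeries.constantCoeff_exp, map_one]
    norm_num
  have hne : e - 1 ≠ 0 := by
    intro h
    have := congrArg (PowerSeries.coeff 1) h
    simp [he, PowerSeries.coeff_exp, PowerSeries.coeff_one] at this
  have hadd : PowerSeries.rescale (y + 1) e = PowerSeries.rescale y e * e := by
    have h := PowerSeries.exp_mul_exp_eq_exp_add (A := ℝ) y 1
    rw [PowerSeries.rescale_one] at h
    simpa using h.symm
  -- From e^(2t) - 1 = (e^t - 1)(e^t + 1): the difference of the two Bernoulli series carries a
  -- factor e^t - 1, which cancels and leaves the Euler denominator.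
  have hmain : (β ((y + 1) / 2) - β (y / 2)) * (e + 1) =
      2 * PowerSeries.X * PowerSeries.rescale y e := by
    refine mul_right_cancel₀ hne ?_
    have h1 := hβ ((y + 1) / 2)
    have h2 := hβ (y / 2)
    rw [mul_div_cancel₀ _ two_ne_zero] at h1 h2
    rw [hadd] at h1
    linear_combination h1 - h2
  have hU : PowerSeries.X * (PowerSeries.C (2 : ℝ) * PowerSeries.rescale y e * (e + 1)⁻¹) =
      β ((y + 1) / 2) - β (y / 2) := by
    have hinv := PowerSeries.mul_inv_cancel (e + 1) hc
    have h2 : PowerSeries.C (2 : ℝ) = 2 := rfl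
    rw [h2]
    linear_combination (-(e + 1)⁻¹) * hmain + (β ((y + 1) / 2) - β (y / 2)) * hinv
  have hcoef := congrArg (PowerSeries.coeff (n + 1)) hU
  rw [PowerSeries.coeff_succ_X_mul] at hcoef
  rw [eulerPoly, ← he, hcoef]
  simp only [β, map_sub, PowerSeries.coeff_rescale, PowerSeries.coeff_mk, Nat.factorial_succ]
  push_cast
  have : (n.factorial : ℝ) ≠ 0 := by exact_mod_cast n.factorial_ne_zero
  field_simp

/-- Shifting u by 1 exchanges u/2 and (u+1)/2 modulo 1, which reproduces the sign (-1)^⌊u⌋. -/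
lemma eulerFn_eq (n : ℕ) (u : ℝ) :
    eulerFn n u = -(2 ^ (n + 1) / (n + 1) *
      (bernoulliPer (n + 1) (u / 2) - bernoulliPer (n + 1) ((u + 1) / 2))) := by
  have hu : u = ⌊u⌋ + Int.fract u := (Int.floor_add_fract u).symm
  have h0 := Int.fract_nonneg u
  have h1 := Int.fract_lt_one u
  have hfr (m : ℤ) (f : ℝ) (hf0 : 0 ≤ f) (hf1 : f < 1) (v : ℝ) (hv : v = f + m) :
      Int.fract v = f := by
    rw [hv, Int.fract_add_intCast, Int.fract_eq_self.2 ⟨hf0, hf1⟩]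
  rw [eulerFn, eulerPoly_eq, bernoulliPer, bernoulliPer]
  rcases Int.even_or_odd ⌊u⌋ with h | h
  · obtain ⟨r, hr⟩ := h.two_dvd
    rw [h.neg_one_zpow, hfr r (Int.fract u / 2) (by linarith) (by linarith) (u / 2),
      hfr r ((Int.fract u + 1) / 2) (by linarith) (by linarith) ((u + 1) / 2)]
    · ring
    · nth_rw 1 [hu]; rw [hr]; push_cast; ring
    · nth_rw 1 [hu]; rw [hr]; push_cast; ring
  · obtain ⟨r, hr⟩ := h
    rw [Odd.neg_one_zpow ⟨r, hr⟩,
      hfr r ((Int.fract u + 1) / 2) (by linarith) (by linarith) (u / 2),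
      hfr (r + 1) (Int.fract u / 2) (by linarith) (by linarith) ((u + 1) / 2)]
    · ring
    · nth_rw 1 [hu]; rw [hr]; push_cast; ring
    · nth_rw 1 [hu]; rw [hr]; push_cast; ring

section CharacterEuler

variable {k : ℕ}

lemma sum_range_two_mul (f : ℕ → ℂ) :
    ∑ J ∈ Finset.range (2 * k), f J = ∑ j ∈ Finset.range k, (f j + f (k + j)) := by
  rw [two_mul, Finset.sum_range_add, Finset.sum_add_distrib]

/-- The character Euler functions in terms of Bernoulli functions. -/
lemma sum_bernoulliPer_eq_charEulerFn [NeZero k] (hk : Odd k) (ψ : DirichletCharacter ℂ k) (m : ℕ)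
    (x : ℝ) :
    ∑ J ∈ Finset.range (2 * k), (-1 : ℂ) ^ J * (star ψ) (J : ZMod k) *
        (bernoulliPer (m + 1) ((J + x) / (2 * k)) : ℂ) =
      -((m + 1 : ℂ) / (2 ^ (m + 1) * k ^ m)) * charEulerFn m ψ x := by
  have hk0 : (k : ℂ) ≠ 0 := by exact_mod_cast NeZero.ne k
  have hk0' : (k : ℝ) ≠ 0 := by exact_mod_cast NeZero.ne k
  have hm : (m + 1 : ℂ) ≠ 0 := by exact_mod_cast m.succ_ne_zero
  rw [sum_range_two_mul, charEulerFn, ← mul_assoc, Finset.mul_sum]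
  refine Finset.sum_congr rfl fun j _ => ?_
  -- J = j and J = k + j have opposite signs because k is odd, and their arguments differ by 1/2:
  -- this is the Bernoulli difference defining 𝓔_m.
  rw [eulerFn_eq, pow_add, hk.neg_one_pow]
  have e1 : ((j : ℝ) + x) / (2 * k) = (j + x) / k / 2 := by field_simp
  have e2 : (((k + j : ℕ) : ℝ) + x) / (2 * k) = ((j + x) / k + 1) / 2 := by
    push_cast; field_simp; ring
  rw [e1, e2]
  push_cast
  simp only [CharP.cast_eq_zero, zero_add]
  field_simp
  ring

end CharacterEuler

/-! ### Periodic sums and unimodular reindexing. -/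

lemma sum_range_eq_sum_zmod {Q : ℕ} [NeZero Q] {M : Type*} [AddCommMonoid M] (f : ℤ → M) :
    ∑ i ∈ Finset.range Q, f i = ∑ x : ZMod Q, f (x.val : ℤ) := by
  refine Finset.sum_nbij' (fun i => (i : ZMod Q)) ZMod.val (fun _ _ => Finset.mem_univ _)
    (fun x _ => Finset.mem_range.2 x.val_lt) (fun i hi => ?_) (fun x _ => by simp) (fun i hi => ?_)
  · exact ZMod.val_cast_of_lt (Finset.mem_range.1 hi)
  · rw [ZMod.val_cast_of_lt (Finset.mem_range.1 hi)]

lemma Periodic.eq_val {Q : ℕ} [NeZero Q] {α : Type*} {f : ℤ → α} (hf : Function.Periodic f (Q : ℤ)) (i : ℤ) :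
    f i = f (((i : ZMod Q).val : ℕ) : ℤ) := by
  rw [ZMod.val_intCast]
  conv_lhs => rw [← Int.emod_add_mul_ediv i Q, mul_comm]
  exact hf.int_mul _ _

lemma Periodic.eq_of_cast_eq {Q : ℕ} [NeZero Q] {α : Type*} {f : ℤ → α} (hf : Function.Periodic f (Q : ℤ)) {i j : ℤ}
    (h : (i : ZMod Q) = j) : f i = f j := by
  rw [Periodic.eq_val hf i, Periodic.eq_val hf j, h]

lemma Periodic.sum_range_mul {Q : ℕ} {f : ℤ → ℂ} (hf : Function.Periodic f (Q : ℤ)) (r : ℕ) :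
    ∑ i ∈ Finset.range (Q * r), f i = r * ∑ i ∈ Finset.range Q, f i := by
  induction r with
  | zero => simp
  | succ r ih =>
    rw [Nat.mul_succ, Finset.sum_range_add, ih]
    have h (i : ℕ) : f ((Q * r + i : ℕ) : ℤ) = f i := by
      have := hf.int_mul r i
      rw [← this]
      push_cast
      congr 1
      ring
    simp only [h]
    push_cast
    ring

/-- Unimodular change of variables in a sum over a doubly periodic function. -/
lemma sum_reindex {k C : ℕ} [NeZero k] [NeZero C] {a b d : ℤ} (hdet : a * d - b * C = 1)
    (hd : Even d) (F : ℤ → ℤ → ℂ) (h1 : ∀ n J, F (n + C * k) J = F n J)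
    (h2 : ∀ n J, F n (J + 2 * k) = F n J) :
    ∑ n ∈ Finset.range (C * k), ∑ J ∈ Finset.range (2 * k), F n J =
      ∑ M ∈ Finset.range (2 * C * k), ∑ s ∈ Finset.range k,
        F (a * M + C * s) (-b * M - d * s) := by
  -- Q is a common period in both variables. Over a full Q × Q square the substitution is a
  -- bijection of (ℤ/Q)², and both sides are counted 2C times.
  set Q := 2 * C * k with hQ
  have : NeZero Q := ⟨by simp [hQ, NeZero.ne k, NeZero.ne C]⟩
  have hC : (C : ℂ) ≠ 0 := by exact_mod_cast NeZero.ne C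
  have p1 (J : ℤ) : Function.Periodic (fun n => F n J) ((C * k : ℕ) : ℤ) := fun n => by
    push_cast; exact h1 n J
  have p2 (n : ℤ) : Function.Periodic (fun J => F n J) ((2 * k : ℕ) : ℤ) := fun J => by
    push_cast; exact h2 n J
  have q1 (J : ℤ) : Function.Periodic (fun n => F n J) (Q : ℤ) := by
    have := (p1 J).int_mul 2
    convert! this using 1
    rw [hQ]; push_cast; ring
  have q2 (n : ℤ) : Function.Periodic (fun J => F n J) (Q : ℤ) := by
    have := (p2 n).int_mul C
    convert! this using 1
    rw [hQ]; push_cast; ring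
  have hcongr {n n' J J' : ℤ} (hn : (n : ZMod Q) = n') (hJ : (J : ZMod Q) = J') :
      F n J = F n' J' := by
    rw [Periodic.eq_of_cast_eq (q1 J) hn]
    exact Periodic.eq_of_cast_eq (q2 n') hJ
  obtain ⟨e, rfl⟩ := hd.two_dvd
  -- Evenness of d enters here: moving s by k moves J by a multiple of 2k.
  have p3 (M : ℤ) : Function.Periodic (fun s => F (a * M + C * s) (-b * M - 2 * e * s)) (k : ℤ) := by
    intro s
    have e1 : a * M + C * (s + k) = a * M + C * s + C * k := by ring
    have e2 : -b * M - 2 * e * (s + k) = -b * M - 2 * e * s + (-e) * ((2 * k : ℕ) : ℤ) := by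
      push_cast; ring
    simp only
    rw [e1, h1, e2]
    exact (p2 _).int_mul (-e) _
  have hleft : ∑ n ∈ Finset.range Q, ∑ J ∈ Finset.range Q, F n J =
      2 * C * ∑ n ∈ Finset.range (C * k), ∑ J ∈ Finset.range (2 * k), F n J := by
    have e1 : Q = 2 * k * C := by rw [hQ]; ring
    have e2 : Q = C * k * 2 := by rw [hQ]; ring
    have (n : ℤ) : ∑ J ∈ Finset.range Q, F n J = C * ∑ J ∈ Finset.range (2 * k), F n J := by
      rw [e1]; exact Periodic.sum_range_mul (p2 n) C
    simp only [this]
    rw [e2, Periodic.sum_range_mul (f := fun n : ℤ => C * ∑ J ∈ Finset.range (2 * k), F n J)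
      (fun n => by simp only [p1 _ n]), ← Finset.mul_sum]
    push_cast
    ring
  have hright : ∑ M ∈ Finset.range Q, ∑ s ∈ Finset.range Q, F (a * M + C * s) (-b * M - 2 * e * s) =
      2 * C * ∑ M ∈ Finset.range Q, ∑ s ∈ Finset.range k, F (a * M + C * s) (-b * M - 2 * e * s) := by
    rw [Finset.mul_sum]
    refine Finset.sum_congr rfl fun M _ => ?_
    have e1 : Q = k * (2 * C) := by rw [hQ]; ring
    rw [e1, Periodic.sum_range_mul (p3 M)]
    push_cast
    ring
  have hmid : ∑ n ∈ Finset.range Q, ∑ J ∈ Finset.range Q, F n J =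
      ∑ M ∈ Finset.range Q, ∑ s ∈ Finset.range Q, F (a * M + C * s) (-b * M - 2 * e * s) := by
    have hl (H : ℤ → ℤ → ℂ) : ∑ n ∈ Finset.range Q, ∑ J ∈ Finset.range Q, H n J =
        ∑ x : ZMod Q, ∑ y : ZMod Q, H x.val y.val := by
      rw [sum_range_eq_sum_zmod (fun n : ℤ => ∑ J ∈ Finset.range Q, H n J)]
      exact Finset.sum_congr rfl fun x _ => sum_range_eq_sum_zmod (fun J : ℤ => H x.val J)
    have hp (H : ℤ → ℤ → ℂ) : ∑ n ∈ Finset.range Q, ∑ J ∈ Finset.range Q, H n J =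
        ∑ x : ZMod Q × ZMod Q, H x.1.val x.2.val := by
      rw [hl, ← Fintype.sum_prod_type' fun x y : ZMod Q => H x.val y.val]
    rw [hp F, hp fun M s => F (a * M + C * s) (-b * M - 2 * e * s)]
    have hdet' : (a : ZMod Q) * (2 * e) - b * C = 1 := by
      exact_mod_cast congrArg (Int.cast : ℤ → ZMod Q) hdet
    let E : ZMod Q × ZMod Q ≃ ZMod Q × ZMod Q :=
      { toFun := fun x => (2 * e * x.1 + C * x.2, -b * x.1 - a * x.2)
        invFun := fun x => (a * x.1 + C * x.2, -b * x.1 - 2 * e * x.2)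
        left_inv := fun x => by
          ext
          · linear_combination x.1 * hdet'
          · linear_combination x.2 * hdet'
        right_inv := fun x => by
          ext
          · linear_combination x.1 * hdet'
          · linear_combination x.2 * hdet' }
    refine Fintype.sum_equiv E _ _ fun x => hcongr ?_ ?_
    · simp [E]
      linear_combination (-x.1) * hdet'
    · simp [E]
      linear_combination (-x.2) * hdet'
  rw [hleft, hright] at hmid
  exact mul_left_cancel₀ (mul_ne_zero two_ne_zero hC) hmid

/-! ### Gauss sums. -/

lemma sum_mul_exp_eq_gauss {k : ℕ} [NeZero k] {χ : DirichletCharacter ℂ k} (hχ : χ.IsPrimitive) (N : ℤ) :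
    ∑ j ∈ Finset.range k, χ (j : ZMod k) * Complex.exp (pole N * (j / k)) =
      χ⁻¹ (N : ZMod k) * gauss χ := by
  rw [gauss, ← gaussSum_mulShift_of_isPrimitive _ hχ, gaussSum]
  have h := sum_range_eq_sum_zmod (Q := k)
    (fun j : ℤ => χ (j : ZMod k) * ZMod.stdAddChar (N := k) ((N * j : ℤ) : ZMod k))
  push_cast at h
  simp only [ZMod.natCast_val, ZMod.cast_id', id_eq] at h
  simp only [AddChar.mulShift_apply]
  rw [← h]
  refine Finset.sum_congr rfl fun j _ => ?_
  have := ZMod.stdAddChar_coe (N := k) (N * j)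
  push_cast at this
  rw [this, pole]
  congr 2
  ring

lemma isUnit_two_zmod {k : ℕ} (hk : Odd k) : IsUnit (2 : ZMod k) := by
  have := (ZMod.isUnit_iff_coprime 2 k).2 (Nat.coprime_two_left.2 hk)
  exact_mod_cast this

lemma mul_inv_apply_eq_one {k : ℕ} (χ : DirichletCharacter ℂ k) {x : ZMod k} (hx : IsUnit x) :
    χ x * χ⁻¹ x = 1 := by
  rw [← MulChar.mul_apply, mul_inv_cancel, MulChar.one_apply hx]

/-- The alternating Gauss sum over a period `2k`. -/
lemma sum_alternating_mul_exp {k : ℕ} [NeZero k] (hk : Odd k) {χ : DirichletCharacter ℂ k} (hχ : χ.IsPrimitive)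
    (N : ℤ) :
    ∑ J ∈ Finset.range (2 * k), (-1 : ℂ) ^ J * χ (J : ZMod k) *
        Complex.exp (pole N * (J / (2 * k))) =
      if Odd N then 2 * χ⁻¹ (N : ZMod k) * χ 2 * gauss χ else 0 := by
  have hk0 : (k : ℂ) ≠ 0 := by exact_mod_cast NeZero.ne k
  have hhalf : Complex.exp (pole N / 2) = (-1 : ℂ) ^ N := by
    rw [← Complex.exp_pi_mul_I, ← Complex.exp_int_mul, pole]
    congr 1
    ring
  have hstep (j : ℕ) : (-1 : ℂ) ^ j * χ (j : ZMod k) * Complex.exp (pole N * (j / (2 * k))) +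
      (-1 : ℂ) ^ (k + j) * χ ((k + j : ℕ) : ZMod k) *
        Complex.exp (pole N * ((k + j : ℕ) / (2 * k))) =
      (1 - (-1 : ℂ) ^ N) * ((-1 : ℂ) ^ j * χ (j : ZMod k) *
        Complex.exp (pole N * (j / (2 * k)))) := by
    have e : pole N * (((k + j : ℕ) : ℂ) / (2 * k)) = pole N / 2 + pole N * (j / (2 * k)) := by
      push_cast; field_simp
    rw [e, Complex.exp_add, hhalf, pow_add, hk.neg_one_pow]
    push_cast
    simp only [CharP.cast_eq_zero, zero_add]
    ring
  rw [sum_range_two_mul]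
  simp only [hstep]
  rw [← Finset.mul_sum]
  split_ifs with hN
  -- For odd N the sign is absorbed into the exponential: with N = 2h - k, (-1)^j e^(πiNj/k) =
  -- e^(2πihj/k).
  · obtain ⟨h, hh⟩ : ∃ h, N + k = 2 * h := by
      obtain ⟨u, hu⟩ := hN
      obtain ⟨v, hv⟩ := hk
      exact ⟨u + v + 1, by rw [hu, hv]; push_cast; ring⟩
    have hterm (j : ℕ) : (-1 : ℂ) ^ j * χ (j : ZMod k) * Complex.exp (pole N * (j / (2 * k))) =
        χ (j : ZMod k) * Complex.exp (pole h * (j / k)) := by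
      have hN' : (N : ℂ) = 2 * h - k := by
        rw [eq_sub_iff_add_eq]
        exact_mod_cast hh
      have e : pole h * (j / k) = (j : ℕ) * (Real.pi * Complex.I) + pole N * (j / (2 * k)) := by
        rw [pole, pole, hN']
        field_simp
        ring
      rw [e, Complex.exp_add, Complex.exp_nat_mul, Complex.exp_pi_mul_I]
      ring
    simp only [hterm]
    rw [sum_mul_exp_eq_gauss hχ, hN.neg_one_zpow]
    have h2 : (N : ZMod k) = 2 * (h : ZMod k) := by
      have := congrArg (fun i : ℤ => (i : ZMod k)) hh
      simpa using this
    rw [h2, map_mul]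
    linear_combination (-2 * χ⁻¹ (h : ZMod k) * gauss χ) *
      mul_inv_apply_eq_one χ (isUnit_two_zmod hk)
  · rw [Int.not_odd_iff_even] at hN
    rw [hN.neg_one_zpow]
    simp

/-! ### Rational generating functions of periodic sequences. -/

/-- The generating function of a periodic sequence, as a rational function. -/
def periodicQuot (Q : ℕ) (f : ℤ → ℂ) (w : ℂ) : ℂ :=
  (∑ i ∈ Finset.range Q, f i * w ^ i) / (w ^ Q - 1)

lemma periodicQuot_eq_tsum {Q : ℕ} [NeZero Q] {f : ℤ → ℂ} (hf : Function.Periodic f (Q : ℤ))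
    (hf1 : ∀ i, ‖f i‖ ≤ 1) (hf0 : f 0 = 0) {w : ℂ} (hw : ‖w‖ < 1) :
    periodicQuot Q f w = -∑' m : ℕ+, f (m : ℕ) * w ^ (m : ℕ) := by
  have hs : Summable fun m : ℕ => f m * w ^ m := by
    refine .of_norm_bounded (summable_geometric_of_lt_one (norm_nonneg w) hw) fun m => ?_
    rw [norm_mul, norm_pow]
    exact mul_le_of_le_one_left (by positivity) (hf1 _)
  have hwQ : w ^ Q - 1 ≠ 0 := by
    rw [sub_ne_zero]
    intro h
    have h1 := congrArg norm h
    rw [norm_pow, norm_one] at h1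
    exact (pow_lt_one₀ (norm_nonneg w) hw (NeZero.ne Q)).ne h1
  have h := hs.sum_add_tsum_nat_add Q
  have hshift (i : ℕ) : f ((i + Q : ℕ) : ℤ) * w ^ (i + Q) = w ^ Q * (f i * w ^ i) := by
    push_cast
    rw [hf, pow_add]
    ring
  simp only [hshift] at h
  rw [tsum_mul_left] at h
  rw [tsum_pnat_eq_tsum_succ (f := fun m : ℕ => f m * w ^ m)]
  have h0 := hs.tsum_eq_zero_add
  simp only [Nat.cast_zero, hf0, zero_mul, zero_add] at h0
  rw [← h0, periodicQuot, div_eq_iff hwQ]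
  linear_combination h

/-- The reflection i ↦ Q - i of the numerator. It transfers poles with negative index to positive
index, where the power series converges. -/
lemma periodicQuot_inv {Q : ℕ} {f : ℤ → ℂ} (hf : Function.Periodic f (Q : ℤ))
    (hf0 : f 0 = 0) {ε : ℂ} (hε : ∀ i, f (-i) = ε * f i) {w : ℂ} (hw : w ≠ 0) :
    periodicQuot Q f w⁻¹ = -ε * periodicQuot Q f w := by
  have hfQ : f Q = 0 := by
    have := hf 0
    rw [zero_add] at this
    rw [this, hf0]
  have hsum (v : ℕ → ℂ) : ∑ i ∈ Finset.range Q, f i * v i =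
      ∑ i ∈ Finset.range (Q + 1), f i * v i := by
    rw [Finset.sum_range_succ, hfQ, zero_mul, add_zero]
  have hwQ : w ^ Q ≠ 0 := pow_ne_zero _ hw
  have hflip : w ^ Q * ∑ i ∈ Finset.range Q, f i * w⁻¹ ^ i =
      ε * ∑ i ∈ Finset.range Q, f i * w ^ i := by
    rw [hsum, hsum, Finset.mul_sum, Finset.mul_sum, ← Finset.sum_flip]
    refine Finset.sum_congr rfl fun i hi => ?_
    have hi' : i ≤ Q := Nat.lt_succ_iff.1 (Finset.mem_range.1 hi)
    have e : f ((Q - i : ℕ) : ℤ) = ε * f i := by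
      rw [← hε, Nat.cast_sub hi', ← hf (-(i : ℤ))]
      congr 1
      ring
    rw [e, inv_pow]
    have : w ^ Q = w ^ i * w ^ (Q - i) := by rw [← pow_add]; congr 1; lia
    rw [this]
    have h1 : w ^ (Q - i) ≠ 0 := pow_ne_zero _ hw
    field_simp
  rcases eq_or_ne (w ^ Q) 1 with h1 | h1
  · simp [periodicQuot, h1]
  have h2 : w ^ Q - 1 ≠ 0 := sub_ne_zero.2 h1
  have h3 : w⁻¹ ^ Q - 1 ≠ 0 := by
    rw [inv_pow, sub_ne_zero, Ne, inv_eq_one]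
    exact h1
  rw [periodicQuot, periodicQuot, div_eq_iff h3]
  refine mul_left_cancel₀ hwQ ?_
  rw [hflip, inv_pow]
  field_simp
  ring

lemma exp_pole_mul_int (N m : ℤ) : Complex.exp (pole N * m) = 1 := by
  rw [Complex.exp_eq_one_iff]
  exact ⟨N * m, by rw [pole]; push_cast; ring⟩

lemma exp_pole_mul_fract (N : ℤ) (x : ℝ) :
    Complex.exp (pole N * (Int.fract x : ℝ)) = Complex.exp (pole N * x) := by
  rw [Int.fract, Complex.ofReal_sub, mul_sub, Complex.exp_sub, Complex.ofReal_intCast,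
    exp_pole_mul_int, div_one]

lemma fract_natCast_div {i Q : ℕ} (h : i < Q) : Int.fract ((i : ℝ) / Q) = i / Q := by
  have hQ : (0 : ℝ) < Q := by exact_mod_cast (Nat.zero_le i).trans_lt h
  rw [Int.fract_eq_self]
  refine ⟨by positivity, ?_⟩
  rw [div_lt_one hQ]
  exact_mod_cast h

lemma dvd_of_fract_div_eq_zero {i : ℤ} {Q : ℕ} (hQ : Q ≠ 0) (h : Int.fract ((i : ℝ) / Q) = 0) :
    (Q : ℤ) ∣ i := by
  have hQ' : (Q : ℝ) ≠ 0 := by exact_mod_cast hQ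
  obtain ⟨m, hm⟩ := Int.fract_eq_zero_iff.1 h
  refine ⟨m, ?_⟩
  rw [eq_div_iff hQ'] at hm
  rw [mul_comm]
  exact_mod_cast hm.symm

lemma fract_mem_Ioo {x : ℝ} (h : Int.fract x ≠ 0) : Int.fract x ∈ Set.Ioo (0 : ℝ) 1 :=
  ⟨lt_of_le_of_ne (Int.fract_nonneg x) h.symm, Int.fract_lt_one x⟩

lemma sum_Icc_one_eq_sum_range (f : ℤ → ℂ) (Q : ℕ) (h : f 0 = f Q) :
    ∑ n ∈ Finset.Icc (1 : ℤ) Q, f n = ∑ n ∈ Finset.range Q, f n := by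
  have h1 : ∑ n ∈ Finset.Icc (1 : ℤ) Q, f n = ∑ n ∈ Finset.range Q, f ((n + 1 : ℕ) : ℤ) := by
    symm
    refine Finset.sum_nbij' (fun n => ((n + 1 : ℕ) : ℤ)) (fun n => (n - 1).toNat) ?_ ?_ ?_ ?_ ?_
    · intro n hn
      have := Finset.mem_range.1 hn
      simp
      lia
    · intro n hn
      have := Finset.mem_Icc.1 hn
      rw [Finset.mem_range]
      lia
    · intro n _
      simp
    · intro n hn
      have := Finset.mem_Icc.1 hn
      push_cast
      lia
    · intro n _
      rfl
  have h2 := Finset.sum_range_succ (fun n : ℕ => f n) Q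
  rw [Finset.sum_range_succ'] at h2
  rw [h1]
  push_cast at h2 ⊢
  rw [h] at h2
  exact add_right_cancel h2

/-! ### Weighted sums of the three families of residues. -/

section WeightedSums

variable {k : ℕ}

lemma periodic_character (ψ : DirichletCharacter ℂ k) {Q : ℤ} (hQ : (k : ℤ) ∣ Q) :
    Function.Periodic (fun i : ℤ => ψ (i : ZMod k)) Q := by
  intro i
  have : (Q : ZMod k) = 0 := (ZMod.intCast_zmod_eq_zero_iff_dvd Q k).2 hQ
  simp [this]

/-- The coefficients `ψ(n) (-1)^J ψ̄(J)`. -/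
def weight (ψ : DirichletCharacter ℂ k) (n J : ℤ) : ℂ :=
  ψ (n : ZMod k) * ((-1 : ℂ) ^ J * (star ψ) (J : ZMod k))

lemma weight_add_left (ψ : DirichletCharacter ℂ k) (C : ℕ) (n J : ℤ) :
    weight ψ (n + C * k) J = weight ψ n J := by
  simp [weight]

lemma weight_add_right (ψ : DirichletCharacter ℂ k) (n J : ℤ) :
    weight ψ n (J + 2 * k) = weight ψ n J := by
  have : Even (2 * (k : ℤ)) := even_two_mul _
  simp [weight, zpow_add₀, this.neg_one_zpow]

/-- The parameter of the first factor of the kernel. -/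
def leftPt (k C : ℕ) (n : ℤ) : ℝ := n / (C * k : ℕ)

/-- The parameter of the second factor of the kernel. -/
def rightPt (k C : ℕ) (d n J : ℤ) : ℝ := (C * J + d * n : ℤ) / (2 * C * k : ℕ)

lemma leftPt_add [NeZero k] (C : ℕ) [NeZero C] (n : ℤ) :
    leftPt k C (n + C * k) = leftPt k C n + (1 : ℤ) := by
  have h1 : (k : ℝ) ≠ 0 := by exact_mod_cast NeZero.ne k
  have h2 : (C : ℝ) ≠ 0 := by exact_mod_cast NeZero.ne C
  simp only [leftPt]
  push_cast
  field_simp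

/-- The even entry is written 2e because the shift is half of it, and must be an integer for
periodicity. -/
lemma rightPt_add_left [NeZero k] (C : ℕ) [NeZero C] (e n J : ℤ) :
    rightPt k C (2 * e) (n + C * k) J = rightPt k C (2 * e) n J + e := by
  have h1 : (k : ℝ) ≠ 0 := by exact_mod_cast NeZero.ne k
  have h2 : (C : ℝ) ≠ 0 := by exact_mod_cast NeZero.ne C
  simp only [rightPt]
  push_cast
  field_simp
  ring

lemma rightPt_add_right [NeZero k] (C : ℕ) [NeZero C] (d n J : ℤ) :
    rightPt k C d n (J + 2 * k) = rightPt k C d n J + (1 : ℤ) := by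
  have h1 : (k : ℝ) ≠ 0 := by exact_mod_cast NeZero.ne k
  have h2 : (C : ℝ) ≠ 0 := by exact_mod_cast NeZero.ne C
  simp only [rightPt]
  push_cast
  field_simp
  ring

lemma rightPt_reindex {C : ℕ} {a b d : ℤ} (hdet : a * d - b * C = 1) (M s : ℤ) :
    rightPt k C d (a * M + C * s) (-b * M - d * s) = M / (2 * C * k : ℕ) := by
  have : C * (-b * M - d * s) + d * (a * M + C * s) = M := by linear_combination M * hdet
  rw [rightPt, this]

/-- The compatibility of the weights with the change of variables attached to a matrix. -/
def WeightSplits (C : ℕ) (a b d : ℤ) (χ ψ : DirichletCharacter ℂ k) (κ : ℂ) : Prop :=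
  ∀ M s : ℤ, weight ψ (a * M + C * s) (-b * M - d * s) =
    κ * ((-1 : ℂ) ^ M * χ (M : ZMod k)) * (star χ) (s : ZMod k)

variable [NeZero k] {C : ℕ} [NeZero C] {a b d : ℤ} {χ ψ : DirichletCharacter ℂ k} {κ : ℂ}

lemma sum_weight_reindex (hdet : a * d - b * C = 1) (hd : Even d)
    (hW : WeightSplits C a b d χ ψ κ) (G : ℝ → ℝ → ℂ) (hG1 : ∀ x y (m : ℤ), G (x + m) y = G x y)
    (hG2 : ∀ x y (m : ℤ), G x (y + m) = G x y) :
    ∑ n ∈ Finset.range (C * k), ∑ J ∈ Finset.range (2 * k),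
        weight ψ n J * G (leftPt k C n) (rightPt k C d n J) =
      ∑ M ∈ Finset.range (2 * C * k), ∑ s ∈ Finset.range k,
        κ * ((-1 : ℂ) ^ M * χ (M : ZMod k)) * (star χ) (s : ZMod k) *
          G (leftPt k C (a * M + C * s)) (M / (2 * C * k : ℕ)) := by
  have h := sum_reindex (k := k) hdet hd
    (fun n J => weight ψ n J * G (leftPt k C n) (rightPt k C d n J)) ?_ ?_
  · rw [h]
    refine Finset.sum_congr rfl fun M _ => Finset.sum_congr rfl fun s _ => ?_
    rw [hW, rightPt_reindex hdet]
    simp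
  · intro n J
    obtain ⟨e, rfl⟩ := hd.two_dvd
    rw [weight_add_left, leftPt_add, hG1, rightPt_add_left, hG2]
  · intro n J
    rw [weight_add_right, rightPt_add_right, hG2]

lemma sum_first (hdet : a * d - b * C = 1) (hd : Even d) (hW : WeightSplits C a b d χ ψ κ)
    (hχ : (star χ).IsPrimitive) {γ τ : ℂ} (hτ : γ⁻¹ = 2 * C * τ - 2 * a) (N : ℤ) :
    ∑ n ∈ Finset.range (C * k), ∑ J ∈ Finset.range (2 * k),
        weight ψ n J * (Complex.exp (pole N * (Int.fract (leftPt k C n) : ℝ)) *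
          expKernel (Int.fract (rightPt k C d n J)) (pole N / γ)) =
      κ * (χ (N : ZMod k) * gauss (star χ)) *
        periodicQuot (2 * C * k) (fun i => (-1 : ℂ) ^ i * χ (i : ZMod k))
          (Complex.exp (pole N * (τ / k))) := by
  have hk0 : (k : ℂ) ≠ 0 := by exact_mod_cast NeZero.ne k
  have hC0 : (C : ℂ) ≠ 0 := by exact_mod_cast NeZero.ne C
  rw [sum_weight_reindex hdet hd hW (fun x y => Complex.exp (pole N * (Int.fract x : ℝ)) *
    expKernel (Int.fract y) (pole N / γ)) (by simp) (by simp)]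
  have hG := sum_mul_exp_eq_gauss hχ N
  have hinv : (star χ)⁻¹ = χ := by rw [MulChar.star_eq_inv, inv_inv]
  rw [hinv] at hG
  -- Since 2Cτ = 1/γ + 2a, the geometric denominator coincides with that of the kernel.
  have hwQ : Complex.exp (pole N * (τ / k)) ^ (2 * C * k) = Complex.exp (pole N / γ) := by
    have e : ((2 * C * k : ℕ) : ℂ) * (pole N * (τ / k)) = pole N / γ + pole N * (2 * a : ℤ) := by
      rw [div_eq_mul_inv (pole N), hτ]
      push_cast
      field_simp
      ring
    rw [← Complex.exp_nat_mul, e, Complex.exp_add, exp_pole_mul_int, mul_one]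
  rw [← hG, periodicQuot, hwQ, Finset.sum_div, Finset.mul_sum]
  refine Finset.sum_congr rfl fun M hM => ?_
  rw [Finset.mul_sum, Finset.sum_mul]
  refine Finset.sum_congr rfl fun s _ => ?_
  have hexp : Complex.exp (pole N * (leftPt k C (a * M + C * s) : ℝ)) *
      Complex.exp (((M : ℝ) / (2 * C * k : ℕ) : ℝ) * (pole N / γ)) =
      Complex.exp (pole N * (s / k)) * Complex.exp (pole N * (τ / k)) ^ M := by
    rw [← Complex.exp_add, ← Complex.exp_nat_mul, ← Complex.exp_add, div_eq_mul_inv (pole N), hτ,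
      leftPt]
    congr 1
    push_cast
    field_simp
    ring
  have hfr := fract_natCast_div (Finset.mem_range.1 hM)
  simp only [Int.cast_natCast]
  rw [exp_pole_mul_fract, hfr, expKernel, zpow_natCast]
  linear_combination (κ * ((-1 : ℂ) ^ M * χ (M : ZMod k)) * (star χ) (s : ZMod k) /
    (Complex.exp (pole N / γ) - 1)) * hexp

lemma sum_second (hk : Odd k) (hd : Even d) (hψ : (star ψ).IsPrimitive) {z γ : ℂ}
    (hγ : γ = -(C * z + d) / 2) (N : ℤ) :
    ∑ n ∈ Finset.range (C * k), ∑ J ∈ Finset.range (2 * k),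
        weight ψ n J * (Complex.exp (pole N * (Int.fract (rightPt k C d n J) : ℝ)) *
          expKernel (Int.fract (leftPt k C n)) (γ * pole N)) =
      (if Odd N then 2 * ψ (N : ZMod k) * (star ψ) 2 * gauss (star ψ) else 0) *
        periodicQuot (C * k) (fun i => ψ (i : ZMod k))
          (Complex.exp (-(pole N * (z / (2 * k))))) := by
  have hk0 : (k : ℂ) ≠ 0 := by exact_mod_cast NeZero.ne k
  have hC0 : (C : ℂ) ≠ 0 := by exact_mod_cast NeZero.ne C
  obtain ⟨e, rfl⟩ := hd.two_dvd
  have hG := sum_alternating_mul_exp hk hψ N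
  have hinv : (star ψ)⁻¹ = ψ := by rw [MulChar.star_eq_inv, inv_inv]
  rw [hinv] at hG
  have hwQ : Complex.exp (-(pole N * (z / (2 * k)))) ^ (C * k) = Complex.exp (γ * pole N) := by
    have e : ((C * k : ℕ) : ℂ) * -(pole N * (z / (2 * k))) = γ * pole N + pole N * (e : ℤ) := by
      rw [hγ]
      push_cast
      field_simp
      ring
    rw [← Complex.exp_nat_mul, e, Complex.exp_add, exp_pole_mul_int, mul_one]
  rw [← hG, periodicQuot, hwQ, Finset.sum_div, Finset.mul_sum]
  refine Finset.sum_congr rfl fun n hn => ?_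
  rw [Finset.sum_mul]
  refine Finset.sum_congr rfl fun J _ => ?_
  have hexp : Complex.exp (pole N * (rightPt k C (2 * e) n J : ℝ)) *
      Complex.exp (((n : ℝ) / (C * k : ℕ) : ℝ) * (γ * pole N)) =
      Complex.exp (pole N * (J / (2 * k))) * Complex.exp (-(pole N * (z / (2 * k)))) ^ n := by
    rw [← Complex.exp_add, ← Complex.exp_nat_mul, ← Complex.exp_add, hγ, rightPt]
    congr 1
    push_cast
    field_simp
    ring
  have hfr := fract_natCast_div (Finset.mem_range.1 hn)
  rw [exp_pole_mul_fract, leftPt, Int.cast_natCast, hfr, expKernel, weight]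
  simp only [Int.cast_natCast, zpow_natCast]
  linear_combination (ψ (n : ZMod k) * ((-1 : ℂ) ^ J * (star ψ) (J : ZMod k)) /
    (Complex.exp (γ * pole N) - 1)) * hexp

lemma rightPt_eq (n J : ℤ) : rightPt k C d n J = (J + d * n / C) / (2 * k) := by
  have h1 : (k : ℝ) ≠ 0 := by exact_mod_cast NeZero.ne k
  have h2 : (C : ℝ) ≠ 0 := by exact_mod_cast NeZero.ne C
  rw [rightPt]
  push_cast
  field_simp

/-- The contribution of the origin. -/
lemma sum_bernoulliTerm (hk : Odd k) (hdet : a * d - b * C = 1) (hd : Even d)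
    (hW : WeightSplits C a b d χ ψ κ) (hχ : (star χ) ≠ 1) (hψ : (star ψ).IsPrimitive)
    (hψ0 : ψ 0 = 0) {z γ : ℂ}
    (hγ : γ = -(C * z + d) / 2) (hγ0 : γ ≠ 0) (p : ℕ) :
    ∑ n ∈ Finset.range (C * k), ∑ J ∈ Finset.range (2 * k),
        weight ψ n J * bernoulliTerm p γ (Int.fract (leftPt k C n))
          (Int.fract (rightPt k C d n J)) =
      -(1 / (2 ^ p * p.factorial)) * g1 C d z p ψ := by
  have hk0 : (k : ℂ) ≠ 0 := by exact_mod_cast NeZero.ne k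
  let S (m : ℕ) : ℂ := ∑ n ∈ Finset.range (C * k), ∑ J ∈ Finset.range (2 * k),
    weight ψ n J * ((bernoulliPer m (leftPt k C n) : ℂ) *
      bernoulliPer (p + 1 - m) (rightPt k C d n J))
  -- B₀ = 1 removes the dependence on x, so after reindexing the s-sum is a full sum of a nontrivial
  -- character.
  have hS0 : S 0 = 0 := by
    have := sum_weight_reindex hdet hd hW
      (fun x y => (bernoulliPer 0 x : ℂ) * bernoulliPer (p + 1 - 0) y)
      (by simp [bernoulliPer]) (by simp [bernoulliPer])
    simp only [S]
    rw [this]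
    refine Finset.sum_eq_zero fun M _ => ?_
    have h0 : ∑ s ∈ Finset.range k, (star χ) (s : ZMod k) = 0 := by
      have h1 := sum_range_eq_sum_zmod (Q := k) (fun s : ℤ => (star χ) (s : ZMod k))
      simp only [Int.cast_natCast, ZMod.natCast_val, ZMod.intCast_cast, ZMod.cast_id', id_eq] at h1
      rw [h1]
      exact MulChar.sum_eq_zero_of_ne_one hχ
    simp only [bernoulliPer, bernoulliFun_zero, Complex.ofReal_one, one_mul]
    rw [← Finset.sum_mul, ← Finset.mul_sum]
    simp only [h0, mul_zero, zero_mul]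
  -- Here B₀ removes the dependence on y; the J-sum is the alternating Gauss sum at N = 0, which is
  -- even.
  have hSp : S (p + 1) = 0 := by
    simp only [S]
    refine Finset.sum_eq_zero fun n _ => ?_
    have h0 := sum_alternating_mul_exp hk hψ 0
    simp only [pole, Int.cast_zero, mul_zero, zero_mul, Complex.exp_zero, mul_one] at h0
    simp only [bernoulliPer, Nat.sub_self, bernoulliFun_zero, Complex.ofReal_one, mul_one, weight,
      Int.cast_natCast, zpow_natCast]
    rw [← Finset.sum_mul, ← Finset.mul_sum, h0]
    simp
  have hSm (m : ℕ) (hm : m ∈ Finset.Icc 1 p) : S m =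
      -(((p + 1 - m : ℕ) : ℂ) / (2 ^ (p + 1 - m) * k ^ (p - m))) *
        ∑ n ∈ Finset.Icc (1 : ℤ) (C * (k : ℤ)), ψ (n : ZMod k) *
          charEulerFn (p - m) ψ ((d : ℝ) * (n : ℝ) / ((C : ℤ) : ℝ)) *
          (bernoulliFn m ((n : ℝ) / (((C : ℤ) : ℝ) * (k : ℝ))) : ℂ) := by
    have hm' := Finset.mem_Icc.1 hm
    have hsum := sum_Icc_one_eq_sum_range (fun n : ℤ => ψ (n : ZMod k) *
          charEulerFn (p - m) ψ ((d : ℝ) * (n : ℝ) / ((C : ℤ) : ℝ)) *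
          (bernoulliFn m ((n : ℝ) / (((C : ℤ) : ℝ) * (k : ℝ))) : ℂ)) (C * k) (by simp [hψ0])
    push_cast at hsum ⊢
    rw [hsum, Finset.mul_sum]
    refine Finset.sum_congr rfl fun n hn => ?_
    have hE := sum_bernoulliPer_eq_charEulerFn hk ψ (p - m) (d * n / C)
    have e1 : p + 1 - m = p - m + 1 := by lia
    -- The two Bernoulli functions can differ only at integers, that is at n = 0, where ψ vanishes.
    have hb : ψ (n : ZMod k) * (bernoulliPer m (leftPt k C n) : ℂ) =
        ψ (n : ZMod k) * (bernoulliFn m ((n : ℝ) / ((C : ℝ) * (k : ℝ))) : ℂ) := by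
      rcases Nat.eq_zero_or_pos n with rfl | hn0
      · simp [hψ0]
      · have hf : Int.fract ((n : ℝ) / ((C : ℝ) * (k : ℝ))) ≠ 0 := by
          have h1 := fract_natCast_div (Finset.mem_range.1 hn)
          push_cast at h1
          rw [h1]
          have h3 : (k : ℝ) ≠ 0 := by exact_mod_cast NeZero.ne k
          have h2 : (C : ℝ) ≠ 0 := by exact_mod_cast NeZero.ne C
          positivity
        rw [bernoulliFn, if_neg (fun h => hf h.2), bernoulliPer, leftPt]
        push_cast
        rfl
    calc _ = (ψ (n : ZMod k) * (bernoulliPer m (leftPt k C n) : ℂ)) *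
          ∑ J ∈ Finset.range (2 * k), (-1 : ℂ) ^ J * (star ψ) (J : ZMod k) *
            (bernoulliPer (p - m + 1) ((J + d * n / C) / (2 * k)) : ℂ) := by
          rw [Finset.mul_sum]
          refine Finset.sum_congr rfl fun J _ => ?_
          rw [rightPt_eq, weight, e1]
          simp only [Int.cast_natCast, zpow_natCast]
          ring
      _ = _ := by
          rw [hE, hb, e1]
          push_cast
          ring
  have hmain : ∑ n ∈ Finset.range (C * k), ∑ J ∈ Finset.range (2 * k),
        weight ψ n J * bernoulliTerm p γ (Int.fract (leftPt k C n))
          (Int.fract (rightPt k C d n J)) =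
      ∑ m ∈ Finset.range (p + 2),
        γ ^ m / γ / (m.factorial * (p + 1 - m).factorial) * S m := by
    simp only [S, bernoulliTerm, Finset.mul_sum]
    rw [Finset.sum_comm (s := Finset.range (p + 2))]
    refine Finset.sum_congr rfl fun n _ => ?_
    rw [Finset.sum_comm (s := Finset.range (p + 2))]
    refine Finset.sum_congr rfl fun J _ => Finset.sum_congr rfl fun m _ => ?_
    rw [bernoulliPer, bernoulliPer]
    ring
  have hsub : Finset.Icc 1 p ⊆ Finset.range (p + 2) := fun m hm => by
    have := Finset.mem_Icc.1 hm
    rw [Finset.mem_range]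
    lia
  rw [hmain, g1, Finset.mul_sum, ← Finset.sum_subset hsub]
  · refine Finset.sum_congr rfl fun m hm => ?_
    rw [hSm m hm, ← mul_assoc, ← mul_assoc]
    congr 1
    obtain ⟨hm1, hm2⟩ := Finset.mem_Icc.1 hm
    obtain ⟨i, rfl⟩ : ∃ i, m = i + 1 := ⟨m - 1, by lia⟩
    obtain ⟨r, rfl⟩ : ∃ r, p = i + 1 + r := ⟨p - (i + 1), by lia⟩
    have e1 : i + 1 + r + 1 - (i + 1) = r + 1 := by lia
    have e2 : i + 1 + r - (i + 1) = r := by lia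
    have e3 : i + 1 - 1 = i := by lia
    have e4 : ((i + 1 : ℕ) : ℤ) - ((i + 1 + r : ℕ) : ℤ) = -(r : ℤ) := by push_cast; ring
    have hch : (((i + 1 + r).choose (i + 1) : ℕ) : ℂ) * (i + 1).factorial * r.factorial =
        (i + 1 + r).factorial := by
      rw [Nat.choose_symm_add]
      exact_mod_cast Nat.add_choose_mul_factorial_mul_factorial (i + 1) r
    have f1 : ((i + 1).factorial : ℂ) ≠ 0 := by exact_mod_cast Nat.factorial_ne_zero _
    have f2 : (r.factorial : ℂ) ≠ 0 := by exact_mod_cast Nat.factorial_ne_zero _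
    have f3 : (((i + 1 + r).choose (i + 1) : ℕ) : ℂ) ≠ 0 := by
      exact_mod_cast (Nat.choose_pos hm2).ne'
    have f4 : (r : ℂ) + 1 ≠ 0 := Nat.cast_add_one_ne_zero r
    have hγi : (-(((C : ℤ) : ℂ) * z + d)) ^ i = 2 ^ i * γ ^ i := by
      rw [← mul_pow, hγ, Int.cast_natCast]
      congr 1
      ring
    rw [e1, e2, e3, e4, zpow_neg, zpow_natCast, hγi, Nat.factorial_succ r, ← hch]
    push_cast
    field_simp
    ring
  · intro m hm hm'
    have h1 := Finset.mem_range.1 hm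
    have h2 : m = 0 ∨ m = p + 1 := by
      rw [Finset.mem_Icc] at hm'
      lia
    rcases h2 with rfl | rfl
    · rw [hS0, mul_zero]
    · rw [hSp, mul_zero]

end WeightedSums

/-! ### Identification of the residue sums with `A1` and `B`. -/

section Series

variable {k : ℕ}

lemma character_apply_eq_zero_of_dvd {ψ : DirichletCharacter ℂ k} (hψ0 : ψ 0 = 0) {n : ℤ} (h : (k : ℤ) ∣ n) :
    ψ (n : ZMod k) = 0 := by
  rw [(ZMod.intCast_zmod_eq_zero_iff_dvd n k).2 h, hψ0]

lemma character_apply_neg (χ : DirichletCharacter ℂ k) (n : ZMod k) : χ (-n) = χ (-1) * χ n := by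
  rw [← map_mul, neg_one_mul]

lemma character_neg_one_mul_self (χ : DirichletCharacter ℂ k) : χ (-1) * χ (-1) = 1 := by
  rw [← map_mul]; simp

variable [NeZero k] {C : ℕ} [NeZero C] {a b d : ℤ} {χ ψ : DirichletCharacter ℂ k} {κ : ℂ}

/-- An integral parameter forces k ∣ n or k ∣ CJ + dn; the weight carries the factor ψ(n) and, after
splitting, χ(CJ + dn). Thus the residue identity is needed only on the open square. -/
lemma fract_ne_zero_of_weight_ne_zero (hdet : a * d - b * C = 1) (hW : WeightSplits C a b d χ ψ κ)
    (hψ0 : ψ 0 = 0) (hχ0 : χ 0 = 0) {n J : ℤ} (h : weight ψ n J ≠ 0) :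
    Int.fract (leftPt k C n) ≠ 0 ∧ Int.fract (rightPt k C d n J) ≠ 0 := by
  constructor
  · intro h0
    have hdvd := dvd_of_fract_div_eq_zero (by simp [NeZero.ne]) h0
    refine h ?_
    rw [weight, character_apply_eq_zero_of_dvd hψ0 ((Dvd.intro_left (C : ℤ) (by simp)).trans hdvd),
      zero_mul]
  · intro h0
    have hdvd := dvd_of_fract_div_eq_zero (by simp [NeZero.ne]) h0
    have hw := hW (C * J + d * n) (-(b * n + a * J))
    have e1 : a * (C * J + d * n) + C * -(b * n + a * J) = n := by linear_combination n * hdet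
    have e2 : -b * (C * J + d * n) - d * -(b * n + a * J) = J := by linear_combination J * hdet
    rw [e1, e2, character_apply_eq_zero_of_dvd hχ0
      ((Dvd.intro_left (2 * C : ℤ) (by simp)).trans hdvd)] at hw
    exact h (by simpa using hw)

lemma summable_weight_mul {w : ℂ} {f : ℤ → ℂ} (h : w ≠ 0 → Summable f) :
    Summable fun N => w * f N := by
  rcases eq_or_ne w 0 with rfl | hw
  · simp
  · exact (h hw).mul_left w

lemma tsum_int_of_even {f : ℤ → ℂ} (hf : f.Even) (hs : Summable f) (h0 : f 0 = 0) :
    ∑' N, f N = 2 * ∑' N : ℕ+, f N := by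
  rw [tsum_int_eq_zero_add_two_mul_tsum_pnat hf hs, h0, zero_add, nsmul_eq_mul, Nat.cast_ofNat]

lemma norm_exp_pole_mul_lt_one {τ : ℂ} (hτ : 0 < τ.im) (N : ℕ+) :
    ‖Complex.exp (pole ((N : ℕ) : ℤ) * (τ / k))‖ < 1 := by
  have hk0 : (0 : ℝ) < k := by exact_mod_cast Nat.pos_of_ne_zero (NeZero.ne k)
  have hN : (0 : ℝ) < (N : ℕ) := by exact_mod_cast N.pos
  rw [Complex.norm_exp, Real.exp_lt_one_iff]
  have e : pole ((N : ℕ) : ℤ) * (τ / k) = ((2 * Real.pi * (N : ℕ) / k : ℝ) : ℂ) * (Complex.I * τ) := by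
    rw [pole]; push_cast; ring
  rw [e, Complex.re_ofReal_mul]
  simp only [Complex.I_mul_re, mul_neg]
  have := Real.pi_pos
  have : 0 < 2 * Real.pi * (N : ℕ) / k * τ.im := by positivity
  linarith

lemma pole_neg (N : ℤ) : pole (-N) = -pole N := by simp [pole]

lemma cpow_one_sub_sub_one (n p : ℕ) : (n : ℂ) ^ ((1 : ℂ) - (p : ℂ) - 1) = ((n : ℂ) ^ p)⁻¹ := by
  rw [show (1 : ℂ) - (p : ℂ) - 1 = -(p : ℂ) by ring, Complex.cpow_neg, Complex.cpow_natCast]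

lemma exp_neg_pole_mul_inv (N : ℤ) (u : ℂ) :
    Complex.exp (pole (-N) * u) = (Complex.exp (pole N * u))⁻¹ := by
  rw [pole_neg, neg_mul, Complex.exp_neg]

/-- For odd p the summand is even in N: the power gives -1, the character χ(-1), the inversion of
`periodicQuot` -χ(-1). The sum is twice that over N > 0, where the quotient is a power series. -/
lemma tsum_first {p : ℕ} (hp : Odd p) (hχ0 : χ 0 = 0) {τ : ℂ} (hτ : 0 < τ.im) (G : ℂ)
    (hs : Summable fun N : ℤ => (pole N ^ p)⁻¹ * (κ * (χ (N : ZMod k) * G) *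
      periodicQuot (2 * C * k) (fun i => (-1 : ℂ) ^ i * χ (i : ZMod k))
        (Complex.exp (pole N * (τ / k))))) :
    ∑' N : ℤ, (pole N ^ p)⁻¹ * (κ * (χ (N : ZMod k) * G) *
      periodicQuot (2 * C * k) (fun i => (-1 : ℂ) ^ i * χ (i : ZMod k))
        (Complex.exp (pole N * (τ / k)))) =
      -2 * κ * G * ((2 * Real.pi * Complex.I) ^ p)⁻¹ * A1 τ (1 - (p : ℂ)) χ := by
  set f : ℤ → ℂ := fun i => (-1 : ℂ) ^ i * χ (i : ZMod k) with hf
  have : NeZero (2 * C * k) := ⟨by simp [NeZero.ne]⟩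
  have hf0 : f 0 = 0 := by simp [hf, hχ0]
  have hper : Function.Periodic f ((2 * C * k : ℕ) : ℤ) := by
    intro i
    have h1 : Even (2 * (C : ℤ) * (k : ℤ)) := by rw [mul_assoc]; exact even_two_mul _
    simp [hf, zpow_add₀, h1.neg_one_zpow]
  have hneg (i : ℤ) : f (-i) = χ (-1) * f i := by
    simp only [hf, Int.cast_neg]
    rw [character_apply_neg, zpow_neg, ← inv_zpow]
    norm_num
    ring
  have hnorm (i : ℤ) : ‖f i‖ ≤ 1 := by
    simp only [hf, norm_mul, norm_zpow, norm_neg, norm_one, one_zpow, one_mul]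
    exact χ.norm_le_one _
  rw [tsum_int_of_even (fun N => ?_) hs (by simp [pole, hp.pos.ne'])]
  · rw [A1, ← tsum_mul_left, ← tsum_mul_left]
    refine tsum_congr fun N => ?_
    rw [periodicQuot_eq_tsum hper hnorm hf0 (norm_exp_pole_mul_lt_one hτ N)]
    rw [← tsum_neg, ← tsum_mul_left, ← tsum_mul_left, ← tsum_mul_left, ← tsum_mul_left]
    refine tsum_congr fun m => ?_
    rw [cpow_one_sub_sub_one, ← Complex.exp_nat_mul]
    have e : ((m : ℕ) : ℂ) * (pole ((N : ℕ) : ℤ) * (τ / k)) =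
        2 * Real.pi * Complex.I * ((m : ℕ) : ℂ) * ((N : ℕ) : ℂ) * τ / k := by
      rw [pole]; push_cast; ring
    rw [e, pole, mul_pow, mul_inv]
    simp only [hf, Int.cast_natCast, zpow_natCast]
    ring
  · rw [exp_neg_pole_mul_inv, periodicQuot_inv hper hf0 hneg (Complex.exp_ne_zero _), pole_neg,
      hp.neg_pow, inv_neg, Int.cast_neg, character_apply_neg]
    linear_combination ((pole N ^ p)⁻¹ * (κ * (χ (N : ZMod k) * G) *
      periodicQuot (2 * C * k) f (Complex.exp (pole N * (τ / k))))) * character_neg_one_mul_self χ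

lemma tsum_odd_pnat (f : ℕ → ℂ) :
    ∑' N : ℕ+, (if Odd (N : ℕ) then f N else 0) = ∑' n : ℕ, f (2 * n + 1) := by
  let i : ℕ → ℕ+ := fun n => ⟨2 * n + 1, by lia⟩
  have hi : Function.Injective i := fun m n h => by
    have := congrArg PNat.val h
    simp only [i, PNat.mk_coe] at this
    lia
  rw [← hi.tsum_eq]
  · refine tsum_congr fun n => ?_
    simp only [i, PNat.mk_coe]
    exact if_pos (odd_two_mul_add_one n)
  · intro N hN
    rw [Function.mem_support] at hN
    obtain ⟨r, hr⟩ : Odd (N : ℕ) := by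
      by_contra h
      exact hN (if_neg h)
    exact ⟨r, PNat.eq hr.symm⟩

/-- For N > 0 the argument lies outside the unit disc, so it is inverted first; this is the source
of the factor ψ(-1). -/
lemma tsum_second {p : ℕ} (hp : Odd p) (hψ0 : ψ 0 = 0) {z : ℂ} (hz : 0 < z.im) (G : ℂ)
    (hs : Summable fun N : ℤ => (pole N ^ p)⁻¹ *
      ((if Odd N then 2 * ψ (N : ZMod k) * (star ψ) 2 * G else 0) *
        periodicQuot (C * k) (fun i => ψ (i : ZMod k)) (Complex.exp (-(pole N * (z / (2 * k))))))) :
    ∑' N : ℤ, (pole N ^ p)⁻¹ * ((if Odd N then 2 * ψ (N : ZMod k) * (star ψ) 2 * G else 0) *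
        periodicQuot (C * k) (fun i => ψ (i : ZMod k)) (Complex.exp (-(pole N * (z / (2 * k)))))) =
      4 * ψ (-1) * (star ψ) 2 * G * ((2 * Real.pi * Complex.I) ^ p)⁻¹ * B z (1 - (p : ℂ)) ψ := by
  have : NeZero (C * k) := ⟨by simp [NeZero.ne]⟩
  set f : ℤ → ℂ := fun i => ψ (i : ZMod k) with hf
  have hf0 : f 0 = 0 := by simp [hf, hψ0]
  have hper : Function.Periodic f ((C * k : ℕ) : ℤ) :=
    periodic_character ψ (by push_cast; exact Dvd.intro_left _ rfl)
  have hneg (i : ℤ) : f (-i) = ψ (-1) * f i := by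
    simp only [hf, Int.cast_neg]
    rw [character_apply_neg]
  have hnorm (i : ℤ) : ‖f i‖ ≤ 1 := ψ.norm_le_one _
  have hinv (N : ℤ) : Complex.exp (-(pole N * (z / (2 * k)))) =
      (Complex.exp (pole N * (z / 2 / k)))⁻¹ := by
    rw [← Complex.exp_neg, div_div]
  have hq (N : ℤ) : periodicQuot (C * k) f (Complex.exp (-(pole N * (z / (2 * k))))) =
      -ψ (-1) * periodicQuot (C * k) f (Complex.exp (pole N * (z / 2 / k))) := by
    rw [hinv, periodicQuot_inv hper hf0 hneg (Complex.exp_ne_zero _)]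
  simp only [hq] at hs ⊢
  rw [tsum_int_of_even (fun N => ?_) hs (by simp [pole, hp.pos.ne'])]
  · have hN (N : ℕ+) : (pole ((N : ℕ) : ℤ) ^ p)⁻¹ *
        ((if Odd ((N : ℕ) : ℤ) then 2 * ψ (((N : ℕ) : ℤ) : ZMod k) * (star ψ) 2 * G else 0) *
        (-ψ (-1) * periodicQuot (C * k) f (Complex.exp (pole ((N : ℕ) : ℤ) * (z / 2 / k))))) =
        (2 * ψ (-1) * (star ψ) 2 * G * ((2 * Real.pi * Complex.I) ^ p)⁻¹) *
        (if Odd (N : ℕ) then ∑' m : ℕ+, ψ ((m : ℕ) : ZMod k) * ψ ((N : ℕ) : ZMod k) *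
          ((N : ℕ) : ℂ) ^ (1 - (p : ℂ) - 1) *
          Complex.exp (Real.pi * Complex.I * ((m : ℕ) : ℂ) * ((N : ℕ) : ℂ) * z / (k : ℂ))
        else 0) := by
      simp only [Int.odd_coe_nat]
      split_ifs with h
      · rw [periodicQuot_eq_tsum hper hnorm hf0
          (norm_exp_pole_mul_lt_one (by simpa using hz) N)]
        rw [← tsum_neg, ← tsum_mul_left, ← tsum_mul_left, ← tsum_mul_left, ← tsum_mul_left]
        refine tsum_congr fun m => ?_
        rw [cpow_one_sub_sub_one, ← Complex.exp_nat_mul]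
        have e : ((m : ℕ) : ℂ) * (pole ((N : ℕ) : ℤ) * (z / 2 / k)) =
            Real.pi * Complex.I * ((m : ℕ) : ℂ) * ((N : ℕ) : ℂ) * z / k := by
          rw [pole]; push_cast; ring
        rw [e, pole, mul_pow, mul_inv]
        simp only [hf, Int.cast_natCast]
        ring
      · simp
    rw [tsum_congr hN, tsum_mul_left, tsum_odd_pnat (fun N => ∑' m : ℕ+,
      ψ ((m : ℕ) : ZMod k) * ψ (N : ZMod k) * (N : ℂ) ^ (1 - (p : ℂ) - 1) *
          Complex.exp (Real.pi * Complex.I * ((m : ℕ) : ℂ) * (N : ℂ) * z / (k : ℂ))), B]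
    ring
  · rw [exp_neg_pole_mul_inv, periodicQuot_inv hper hf0 hneg (Complex.exp_ne_zero _), pole_neg,
      hp.neg_pow, inv_neg, Int.cast_neg, character_apply_neg]
    simp only [odd_neg]
    split_ifs
    · linear_combination ((pole N ^ p)⁻¹ * 2 * ψ (N : ZMod k) * (star ψ) 2 * G * (-ψ (-1)) *
        periodicQuot (C * k) f (Complex.exp (pole N * (z / 2 / k)))) * character_neg_one_mul_self ψ
    · simp

end Series

/-! ### The transformation formula. -/

section Transformation

variable {k : ℕ}

lemma tsum_sum_weight {ψ : DirichletCharacter ℂ k} {p : ℕ} {γ : ℂ} (u v : ℤ → ℤ → ℝ)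
    (t : ℕ → ℂ → ℝ → ℝ → ℤ → ℂ)
    (hs : ∀ n J, weight ψ n J ≠ 0 → Summable (t p γ (u n J) (v n J))) (A D : ℕ) :
    Summable (fun N : ℤ => ∑ n ∈ Finset.range A, ∑ J ∈ Finset.range D,
        weight ψ n J * t p γ (u n J) (v n J) N) ∧
    ∑ n ∈ Finset.range A, ∑ J ∈ Finset.range D, weight ψ n J * ∑' N, t p γ (u n J) (v n J) N =
      ∑' N : ℤ, ∑ n ∈ Finset.range A, ∑ J ∈ Finset.range D,
        weight ψ n J * t p γ (u n J) (v n J) N := by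
  have h1 (n J : ℤ) : Summable fun N => weight ψ n J * t p γ (u n J) (v n J) N :=
    summable_weight_mul (hs n J)
  have h2 (n : ℤ) : Summable fun N => ∑ J ∈ Finset.range D, weight ψ n J * t p γ (u n J) (v n J) N :=
    summable_sum fun J _ => h1 n J
  refine ⟨summable_sum fun n _ => h2 n, ?_⟩
  rw [Summable.tsum_finsetSum (f := fun (n : ℕ) N => ∑ J ∈ Finset.range D,
    weight ψ n J * t p γ (u n J) (v n J) N) fun n _ => h2 n]
  refine Finset.sum_congr rfl fun n _ => ?_
  rw [Summable.tsum_finsetSum (f := fun (J : ℕ) N => weight ψ n J * t p γ (u n J) (v n J) N)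
    fun J _ => h1 n J]
  exact Finset.sum_congr rfl fun J _ => tsum_mul_left.symm

lemma H1_one_sub {p : ℕ} (hp : Odd p) (τ : ℂ) (χ : DirichletCharacter ℂ k) :
    H1 τ (1 - (p : ℂ)) χ = 2 * A1 τ (1 - (p : ℂ)) χ ∧
      B1 τ (1 - (p : ℂ)) χ = 2 * B τ (1 - (p : ℂ)) χ := by
  obtain ⟨q, rfl⟩ := hp
  have h : Complex.exp (Real.pi * Complex.I * (1 - ((2 * q + 1 : ℕ) : ℂ))) = 1 := by
    rw [Complex.exp_eq_one_iff]
    exact ⟨-q, by push_cast; ring⟩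
  rw [H1, B1, h, one_add_one_eq_two]
  exact ⟨rfl, rfl⟩

lemma isPrimitive_star [NeZero k] {χ : DirichletCharacter ℂ k} (hχ : χ.IsPrimitive) : (star χ).IsPrimitive := by
  rw [MulChar.star_eq_inv, DirichletCharacter.isPrimitive_def, DirichletCharacter.conductor_inv]
  exact hχ

variable [NeZero k] {C : ℕ} [NeZero C] {a b d : ℤ} {χ ψ : DirichletCharacter ℂ k} {κ : ℂ}

/-- The transformation formula for a general splitting of the weights. -/
lemma transformation_of_weightSplits (hk : Odd k) {p : ℕ} (hp : Odd p)
    (hdet : a * d - b * C = 1) (hd : Even d) (hW : WeightSplits C a b d χ ψ κ)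
    (hχ : (star χ).IsPrimitive) (hχ1 : star χ ≠ 1) (hψ : (star ψ).IsPrimitive)
    (hψ0 : ψ 0 = 0) (hχ0 : χ 0 = 0) {z : ℂ} (hz : 0 < z.im) :
    κ * (gauss (star χ) * ((C : ℂ) * z + d) ^ (p - 1) *
        H1 ((a * z + b) / (C * z + d)) (1 - (p : ℂ)) χ) =
      2 ^ p * ψ (-1) * (star ψ) 2 * gauss (star ψ) * B1 z (1 - (p : ℂ)) ψ -
        (2 * Real.pi * Complex.I) ^ p / (2 * p.factorial) * g1 C d z p ψ := by
  have hC0 : (C : ℂ) ≠ 0 := by exact_mod_cast NeZero.ne C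
  have hCpos : (0 : ℝ) < C := by exact_mod_cast Nat.pos_of_ne_zero (NeZero.ne C)
  obtain ⟨γ, hγ⟩ : ∃ γ : ℂ, γ = -(C * z + d) / 2 := ⟨_, rfl⟩
  obtain ⟨τ, hτ⟩ : ∃ τ : ℂ, τ = (a * z + b) / (C * z + d) := ⟨_, rfl⟩
  have hγim : γ.im < 0 := by
    have : γ.im = -(C * z.im) / 2 := by
      rw [hγ]
      simp
    rw [this]
    have := mul_pos hCpos hz
    linarith
  have hγ0 : γ ≠ 0 := fun h => by simp [h] at hγim
  have hden : (C : ℂ) * z + d ≠ 0 := fun h => hγ0 (by rw [hγ, h]; simp)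
  have hdet' : (a : ℂ) * d - b * C = 1 := by exact_mod_cast congrArg (Int.cast : ℤ → ℂ) hdet
  have hτγ : γ⁻¹ = 2 * C * τ - 2 * a := by
    rw [hγ, hτ]
    field_simp
    linear_combination hdet'
  have hτim : 0 < τ.im := by
    have h1 : 0 < (γ⁻¹).im := by
      rw [Complex.inv_im]
      exact div_pos (by linarith) (Complex.normSq_pos.2 hγ0)
    have h2 : (γ⁻¹).im = 2 * C * τ.im := by
      rw [hτγ]
      simp
    rw [h2] at h1
    exact pos_of_mul_pos_right h1 (by positivity)
  have hp0 : p ≠ 0 := hp.pos.ne'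
  have hI {n J : ℤ} (h : weight ψ n J ≠ 0) := fract_ne_zero_of_weight_ne_zero hdet hW hψ0 hχ0 h
  obtain ⟨s1, t1⟩ := tsum_sum_weight (ψ := ψ) (p := p) (γ := γ)
    (fun n _ => Int.fract (leftPt k C n)) (fun n J => Int.fract (rightPt k C d n J)) firstTerm
    (fun n J h => summable_firstTerm hp0 hγim.ne _ (fract_mem_Ioo (hI h).2)) (C * k) (2 * k)
  obtain ⟨s2, t2⟩ := tsum_sum_weight (ψ := ψ) (p := p) (γ := γ)
    (fun n _ => Int.fract (leftPt k C n)) (fun n J => Int.fract (rightPt k C d n J)) secondTerm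
    (fun n J h => summable_secondTerm hp0 hγim.ne _ (fract_mem_Ioo (hI h).1)) (C * k) (2 * k)
  have f1 (N : ℤ) : ∑ n ∈ Finset.range (C * k), ∑ J ∈ Finset.range (2 * k), weight ψ n J *
      firstTerm p γ (Int.fract (leftPt k C n)) (Int.fract (rightPt k C d n J)) N =
      (pole N ^ p)⁻¹ * (κ * (χ (N : ZMod k) * gauss (star χ)) *
        periodicQuot (2 * C * k) (fun i => (-1 : ℂ) ^ i * χ (i : ZMod k))
          (Complex.exp (pole N * (τ / k)))) := by
    rw [← sum_first hdet hd hW hχ hτγ N, Finset.mul_sum]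
    refine Finset.sum_congr rfl fun n _ => ?_
    rw [Finset.mul_sum]
    refine Finset.sum_congr rfl fun J _ => ?_
    rw [firstTerm]
    ring
  have f2 (N : ℤ) : ∑ n ∈ Finset.range (C * k), ∑ J ∈ Finset.range (2 * k), weight ψ n J *
      secondTerm p γ (Int.fract (leftPt k C n)) (Int.fract (rightPt k C d n J)) N =
      (pole N ^ p)⁻¹ * ((if Odd N then 2 * ψ (N : ZMod k) * (star ψ) 2 * gauss (star ψ) else 0) *
        periodicQuot (C * k) (fun i => ψ (i : ZMod k))
          (Complex.exp (-(pole N * (z / (2 * k)))))) := by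
    rw [← sum_second hk hd hψ hγ N, Finset.mul_sum]
    refine Finset.sum_congr rfl fun n _ => ?_
    rw [Finset.mul_sum]
    refine Finset.sum_congr rfl fun J _ => ?_
    rw [secondTerm]
    ring
  simp only [f1] at s1 t1
  simp only [f2] at s2 t2
  rw [tsum_first hp hχ0 hτim _ s1] at t1
  rw [tsum_second hp hψ0 hz _ s2] at t2
  have t3 := sum_bernoulliTerm hk hdet hd hW hχ1 hψ hψ0 hγ hγ0 p
  -- Where the weight vanishes nothing is claimed of the residues; elsewhere both parameters lie in
  -- (0, 1).
  have htotal : ∑ n ∈ Finset.range (C * k), ∑ J ∈ Finset.range (2 * k), weight ψ n J *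
      (γ ^ (p - 1) * (∑' N, firstTerm p γ (Int.fract (leftPt k C n))
          (Int.fract (rightPt k C d n J)) N) +
        (∑' N, secondTerm p γ (Int.fract (leftPt k C n)) (Int.fract (rightPt k C d n J)) N) +
        bernoulliTerm p γ (Int.fract (leftPt k C n)) (Int.fract (rightPt k C d n J))) = 0 := by
    refine Finset.sum_eq_zero fun n _ => Finset.sum_eq_zero fun J _ => ?_
    rcases eq_or_ne (weight ψ n J) 0 with h | h
    · rw [h, zero_mul]
    · rw [kernel_identity hp0 hγim.ne (fract_mem_Ioo (hI h).1) (fract_mem_Ioo (hI h).2), mul_zero]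
  simp only [mul_add, Finset.sum_add_distrib, mul_left_comm _ (γ ^ (p - 1)), ← Finset.mul_sum] at htotal
  rw [t1, t2, t3] at htotal
  rw [(H1_one_sub hp _ χ).1, (H1_one_sub hp z ψ).2, ← hτ]
  have hπ : ((2 * Real.pi * Complex.I : ℂ)) ^ p ≠ 0 := pow_ne_zero _ Complex.two_pi_I_ne_zero
  have hγp : ((C : ℂ) * z + d) ^ (p - 1) = 2 ^ (p - 1) * γ ^ (p - 1) := by
    have : (C : ℂ) * z + d = -(2 * γ) := by rw [hγ]; ring
    have hev : Even (p - 1) := Nat.Odd.sub_odd hp odd_one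
    rw [this, hev.neg_pow, mul_pow]
  have h2p : (2 : ℂ) ^ p = 2 * 2 ^ (p - 1) := by
    rw [← pow_succ']
    congr 1
    have := hp.pos
    lia
  rw [hγp]
  have hfac : (p.factorial : ℂ) ≠ 0 := by exact_mod_cast p.factorial_ne_zero
  rw [h2p] at htotal ⊢
  have h2 : (2 : ℂ) ^ (p - 1) ≠ 0 := pow_ne_zero _ two_ne_zero
  generalize (2 * Real.pi * Complex.I : ℂ) ^ p = P at *
  generalize (2 : ℂ) ^ (p - 1) = T at *
  field_simp at htotal ⊢
  linear_combination (-1) * htotal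

end Transformation

end

end ThetaTwo

/-- The transformation formulas for the character theta-type series `H₁` and `B₁`. -/
theorem mainTheorem3 {k : ℕ} [NeZero k] (hk : Odd k) (χ : DirichletCharacter ℂ k)
    (hprim : χ.IsPrimitive) (hχ : χ ≠ 1) (p : ℕ) (hp : Odd p)
    (a b c d : ℤ) (hdet : a * d - b * c = 1) (hc : 0 < c) (hd : Even d) :
    (a ≡ 0 [ZMOD (k : ℤ)] → d ≡ 0 [ZMOD (k : ℤ)] → ∀ z : ℂ, 0 < z.im →
      ThetaTwo.gauss (star χ) * ((c : ℂ) * z + (d : ℂ)) ^ (p - 1) *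
          ThetaTwo.H1 (((a : ℂ) * z + (b : ℂ)) / ((c : ℂ) * z + (d : ℂ))) (1 - (p : ℂ)) χ =
        (star χ) (b : ZMod k) * χ (c : ZMod k) *
          ((2 : ℂ) ^ p * χ 2 * ThetaTwo.gauss χ * ThetaTwo.B1 z (1 - (p : ℂ)) (star χ) -
            χ (-1) * (2 * Real.pi * Complex.I) ^ p / (2 * (p.factorial : ℂ)) *
              ThetaTwo.g1 c d z p (star χ))) ∧
    (b ≡ 0 [ZMOD (k : ℤ)] → c ≡ 0 [ZMOD (k : ℤ)] → ∀ z : ℂ, 0 < z.im →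
      ThetaTwo.gauss (star χ) * ((c : ℂ) * z + (d : ℂ)) ^ (p - 1) *
          ThetaTwo.H1 (((a : ℂ) * z + (b : ℂ)) / ((c : ℂ) * z + (d : ℂ))) (1 - (p : ℂ)) χ =
        (star χ) (a : ZMod k) * χ (d : ZMod k) *
          ((2 : ℂ) ^ p * (star χ) 2 * ThetaTwo.gauss (star χ) *
              ThetaTwo.B1 z (1 - (p : ℂ)) χ -
            χ (-1) * (2 * Real.pi * Complex.I) ^ p / (2 * (p.factorial : ℂ)) *
              ThetaTwo.g1 c d z p χ)) := by
  obtain ⟨C, rfl⟩ := Int.eq_ofNat_of_zero_le hc.le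
  have : NeZero C := ⟨by rintro rfl; simp at hc⟩
  have hk1 : Fact (1 < k) := ⟨by
    have := NeZero.ne k
    by_contra h
    obtain rfl : k = 1 := by lia
    exact hχ (DirichletCharacter.level_one χ)⟩
  have hstar : (star χ).IsPrimitive := ThetaTwo.isPrimitive_star hprim
  have hss : star (star χ) = χ := star_star χ
  have hχ1 : star χ ≠ 1 := by
    rw [MulChar.star_eq_inv]
    exact inv_ne_one.2 hχ
  have hχ0 : χ 0 = 0 := χ.map_zero
  have hχ0' : (star χ) 0 = 0 := (star χ).map_zero
  have hd1 : IsUnit (-1 : ZMod k) := isUnit_one.neg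
  have hinv (x : ZMod k) (hx : IsUnit x) : χ x * (star χ) x = 1 := by
    rw [MulChar.star_eq_inv]
    exact ThetaTwo.mul_inv_apply_eq_one χ hx
  have hsgn : χ (-1) * χ (-1) = 1 := ThetaTwo.character_neg_one_mul_self χ
  have hsgn' : (star χ) (-1) = χ (-1) := by
    linear_combination χ (-1) * hinv (-1) hd1 - (star χ) (-1) * hsgn
  have hdetZ : (a : ZMod k) * d - b * (C : ZMod k) = 1 := by
    exact_mod_cast congrArg (Int.cast : ℤ → ZMod k) hdet
  have hb_odd : Odd b := by
    by_contra h
    rw [Int.not_odd_iff_even] at h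
    have h1 : Even (a * d - b * C) := (hd.mul_left a).sub (h.mul_right C)
    rw [hdet] at h1
    exact absurd h1 (by decide)
  -- The sign of J depends on M alone, because d is even and the determinant forces b odd.
  have hparity (M s : ℤ) : (-1 : ℂ) ^ (-b * M - d * s) = (-1 : ℂ) ^ M := by
    rcases Int.even_or_odd M with h | h
    · rw [h.neg_one_zpow, Even.neg_one_zpow ((h.mul_left _).sub (hd.mul_right s))]
    · rw [h.neg_one_zpow, Odd.neg_one_zpow ((hb_odd.neg.mul h).sub_even (hd.mul_right s))]
  refine ⟨fun ha hd0 z hz => ?_, fun hb hc0 z hz => ?_⟩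
  · have ha' : (a : ZMod k) = 0 := by
      simpa using (ZMod.intCast_eq_intCast_iff a 0 k).2 ha
    have hd' : (d : ZMod k) = 0 := by
      simpa using (ZMod.intCast_eq_intCast_iff d 0 k).2 hd0
    rw [ha', hd'] at hdetZ
    have hub : IsUnit (b : ZMod k) := IsUnit.of_mul_eq_one (-(C : ZMod k)) (by
      linear_combination hdetZ)
    have huC : IsUnit (C : ZMod k) := IsUnit.of_mul_eq_one (-(b : ZMod k)) (by
      linear_combination hdetZ)
    have hW : ThetaTwo.WeightSplits C a b d χ (star χ) ((star χ) (C : ZMod k) * χ (-b : ZMod k)) := by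
      intro M s
      rw [ThetaTwo.weight, hparity, hss]
      push_cast
      rw [ha', hd', zero_mul, zero_mul, zero_add, sub_zero, map_mul, map_mul]
      ring
    have h := ThetaTwo.transformation_of_weightSplits hk hp hdet hd hW hstar hχ1 (by rwa [hss])
      hχ0' hχ0 hz
    rw [hss, hsgn', ThetaTwo.character_apply_neg] at h
    -- The prefactor χ̄(b)χ(C), times χ(-1), inverts κ. The same χ(-1) cancels the sign of the B₁
    -- term and remains on the g₁ term.
    have hκ : (star χ) (b : ZMod k) * χ (C : ZMod k) * χ (-1) *
        ((star χ) (C : ZMod k) * (χ (-1) * χ (b : ZMod k))) = 1 := by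
      linear_combination (χ (-1) * χ (-1) * χ (C : ZMod k) * (star χ) (C : ZMod k)) * hinv _ hub +
        (χ (-1) * χ (-1)) * hinv _ huC + hsgn
    simp only [Int.cast_natCast] at h ⊢
    linear_combination ((star χ) (b : ZMod k) * χ (C : ZMod k) * χ (-1)) * h -
      (ThetaTwo.gauss (star χ) * ((C : ℂ) * z + (d : ℂ)) ^ (p - 1) *
        ThetaTwo.H1 (((a : ℂ) * z + (b : ℂ)) / ((C : ℂ) * z + (d : ℂ))) (1 - (p : ℂ)) χ) * hκ +
      (star χ) (b : ZMod k) * χ (C : ZMod k) * 2 ^ p * χ 2 * ThetaTwo.gauss χ *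
        ThetaTwo.B1 z (1 - (p : ℂ)) (star χ) * hsgn
  · have hb' : (b : ZMod k) = 0 := by
      simpa using (ZMod.intCast_eq_intCast_iff b 0 k).2 hb
    have hC' : (C : ZMod k) = 0 := by
      simpa using (ZMod.intCast_eq_intCast_iff C 0 k).2 hc0
    rw [hb', hC'] at hdetZ
    have hua : IsUnit (a : ZMod k) := IsUnit.of_mul_eq_one (d : ZMod k) (by
      linear_combination hdetZ)
    have hud : IsUnit (d : ZMod k) := IsUnit.of_mul_eq_one (a : ZMod k) (by
      linear_combination hdetZ)
    have hW : ThetaTwo.WeightSplits C a b d χ χ (χ (a : ZMod k) * (star χ) (-d : ZMod k)) := by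
      intro M s
      rw [ThetaTwo.weight, hparity]
      push_cast
      have e : -(b : ZMod k) * M - d * s = -d * s := by rw [hb']; ring
      rw [e, hC', zero_mul, add_zero, map_mul, map_mul]
      ring
    have h := ThetaTwo.transformation_of_weightSplits hk hp hdet hd hW hstar hχ1 hstar
      hχ0 hχ0 hz
    rw [ThetaTwo.character_apply_neg, hsgn'] at h
    have hκ : (star χ) (a : ZMod k) * χ (d : ZMod k) * χ (-1) *
        (χ (a : ZMod k) * (χ (-1) * (star χ) (d : ZMod k))) = 1 := by
      linear_combination (χ (-1) * χ (-1) * χ (d : ZMod k) * (star χ) (d : ZMod k)) * hinv _ hua +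
        (χ (-1) * χ (-1)) * hinv _ hud + hsgn
    simp only [Int.cast_natCast] at h ⊢
    linear_combination ((star χ) (a : ZMod k) * χ (d : ZMod k) * χ (-1)) * h -
      (ThetaTwo.gauss (star χ) * ((C : ℂ) * z + (d : ℂ)) ^ (p - 1) *
        ThetaTwo.H1 (((a : ℂ) * z + (b : ℂ)) / ((C : ℂ) * z + (d : ℂ))) (1 - (p : ℂ)) χ) * hκ +
      (star χ) (a : ZMod k) * χ (d : ZMod k) * 2 ^ p * (star χ) 2 * ThetaTwo.gauss (star χ) *
        ThetaTwo.B1 z (1 - (p : ℂ)) χ * hsgn
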